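/- Let $d,m\ge 2$ be integers and $\alpha\in(0,2]$. For a real square matrix $A$ and $r>0$ put $r^A=\exp((\ln r)A)$, and let $Q(\mathbb R^n)$ be the set of invertible real $n\times n$ matrices all of whose (complex) eigenvalues have positive real part. Let $E\in Q(\mathbb R^d)$ with transpose $E^*$ and trace $q$, and let $D\in Q(\mathbb R^m)$. Let $a_1$ be the minimal real part of the eigenvalues of $E$ and $H$ the maximal real part of the eigenvalues of $D$, and assume $H<a_1$. Let $\psi:\mathbb R^d\to[0,\infty)$ be continuous with $\psi(y)\ne 0$ for $y\neq 0$ and $E^*$-homogeneous, i.e. $\psi(r^{E^*}y)=r\,\psi(y)$ for all $r>0$, $y\ne 0$. Let $\Gamma$ be the uniform measure on the unit sphere $S_{2m-1}$ of $\mathbb R^{2m}$, normalized so that $\int|\langle s,\theta\rangle|^\alpha\,\Gamma(ds)=|\theta|^\alpha$ for all $\theta\in\mathbb R^{2m}$. Let $\overline M$ be an $\mathbb R^{2m}$-valued symmetric $\alpha$-stable (S$\alpha$S) random measure on $\mathbb R^d$ with control measure $\lambda_d\times\Gamma$ ($\lambda_d$ = Lebesgue measure), defined on a probability space: an independently scattered,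 almost surely $\sigma$-additive set function on the Borel sets $A$ of finite Lebesgue measure such that $\overline M(A)$ is an S$\alpha$S vector with spectral measure $\lambda_d(A)\,\Gamma$. Let $\widetilde M=(\overline M_k+i\,\overline M_{m+k})_{k=1}^m$ be the associated $\mathbb C^m$-valued random measure. For a measurable $\widetilde Q=\widetilde Q_1+i\widetilde Q_2:\mathbb R^d\to\mathbb C^{m\times m}$ (with $\widetilde Q_1,\widetilde Q_2$ real) satisfying $\int(\|\widetilde Q_1\|^\alpha+\|\widetilde Q_2\|^\alpha)\,d\lambda_d<\infty$, the integral $\mathrm{Re}\int\widetilde Q\,d\widetilde M$ is the limit in probability of $\mathrm{Re}\sum_j C_j\widetilde M(A_j)$ along any sequence of simple functions $\sum_j C_j\mathbf 1_{A_j}$ (with $C_j\in\mathbb C^{m\times m}$ and $A_j$ disjoint of finite measure) whose real and imaginary parts converge to $\widetilde Q_1,\widetilde Q_2$ in the sense that $\int\|\cdot\|^\alpha\,d\lambda_d$ of the differences tends to $0$. Then for every $x\in\mathbb R^d$ the stochastic integral $$\widetilde X_\psi(x)=\mathrm{Re}\int_{\mathbb R^d}\bigl(e^{i\langle x,y\rangle}-1\bigr)\,\psi(y)^{-D-qI/\alpha}\,\widetilde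 M(dy)$$ is well defined: its integrand satisfies the above measurability and integrability conditions, and the limit in probability exists, does not depend on the approximating sequence, and is unique almost surely. Moreover, the random field $\widetilde X_\psi=\{\widetilde X_\psi(x),x\in\mathbb R^d\}$ 1. is S$\alpha$S, i.e. all its finite-dimensional distributions are symmetric $\alpha$-stable; 2. is stochastically continuous, i.e. continuous in probability at each point of $\mathbb R^d$; 3. is proper, i.e. for each $x\ne0$ the support of the law of $\widetilde X_\psi(x)$ is not contained in any proper hyperplane of $\mathbb R^m$; 4. is $(E,D)$-operator-self-similar, i.e. for every $r>0$ the fields $\{\widetilde X_\psi(r^Ex),x\in\mathbb R^d\}$ and $\{r^D\widetilde X_\psi(x),x\in\mathbb R^d\}$ have the same finite-dimensional distributions; 5. has stationary increments, i.e. for every $h\in\mathbb R^d$ the fields $\{\widetilde X_\psi(x+h)-\widetilde X_\psi(h),x\in\mathbb R^d\}$ and $\{\widetilde X_\psi(x)-\widetilde X_\psi(0),x\in\mathbb R^d\}$ have the same finite-dimensional distributions. -/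

import Mathlib

open MeasureTheory ProbabilityTheory Filter Topology Matrix
open scoped ENNReal RealInnerProductSpace

noncomputable section

namespace StableField

/-- Euclidean space `ℝⁿ`. -/
abbrev Vec (n : ℕ) : Type := EuclideanSpace ℝ (Fin n)

/-! ### Linear operators, their eigenvalues and powers `r ^ A` -/

/-- The (complex) eigenvalues of a real square matrix. -/
def eigenvalues {n : ℕ} (A : Matrix (Fin n) (Fin n) ℝ) : Set ℂ :=
  spectrum ℂ (A.map (fun t : ℝ => (t : ℂ)))

/-- `Q(ℝⁿ)`: the invertible operators all of whose eigenvalues have positive real part. -/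
def posOperators (n : ℕ) : Set (Matrix (Fin n) (Fin n) ℝ) :=
  {A | IsUnit A ∧ ∀ z ∈ eigenvalues A, 0 < z.re}

/-- The maximal real part of the eigenvalues. -/
def maxRealPart {n : ℕ} (A : Matrix (Fin n) (Fin n) ℝ) : ℝ :=
  sSup (Complex.re '' eigenvalues A)

/-- The minimal real part of the eigenvalues. -/
def minRealPart {n : ℕ} (A : Matrix (Fin n) (Fin n) ℝ) : ℝ :=
  sInf (Complex.re '' eigenvalues A)

/-- `r ^ A = exp ((ln r) A)`, meant for `r > 0`. -/
def opPow {n : ℕ} (r : ℝ) (A : Matrix (Fin n) (Fin n) ℝ) : Matrix (Fin n) (Fin n) ℝ :=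
  NormedSpace.exp (Real.log r • A)

/-- The operator on Euclidean space given by a matrix; its norm is the operator norm
`max_{|x| = 1} |A x|`. -/
def op {n : ℕ} (A : Matrix (Fin n) (Fin n) ℝ) : Vec n →L[ℝ] Vec n :=
  Matrix.toEuclideanCLM (𝕜 := ℝ) A

/-- `ψ` is `Θ`-homogeneous. -/
def IsHomogeneous {d : ℕ} (Θ : Matrix (Fin d) (Fin d) ℝ) (ψ : Vec d → ℝ) : Prop :=
  ∀ r : ℝ, 0 < r → ∀ x : Vec d, x ≠ 0 → ψ (op (opPow r Θ) x) = r * ψ x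

/-! ### Symmetric stable laws and vector-valued symmetric stable random measures -/

/-- A law `μ` on a vector space is symmetric `α`-stable: it is symmetric, and for independent
`X₁, X₂` with law `μ` and all `a, b > 0`, the vector `a X₁ + b X₂` has the law of
`(a ^ α + b ^ α) ^ (1 / α) X₁`. -/
structure IsSymmetricStable {V : Type*} [AddCommGroup V] [Module ℝ V] [MeasurableSpace V]
    (α : ℝ) (μ : Measure V) : Prop where
  symmetric : μ.map (fun v => -v) = μ
  stable : ∀ a b : ℝ, 0 < a → 0 < b →
    (μ.map (fun v => a • v)).conv (μ.map (fun v => b • v)) =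
      μ.map (fun v => (a ^ α + b ^ α) ^ (1 / α) • v)

/-- The law `μ` is (jointly) symmetric `α`-stable with spectral measure `Γ` on the unit sphere. -/
def HasSpectralMeasure {ι : Type*} [Fintype ι] (α : ℝ) (μ : Measure (EuclideanSpace ℝ ι))
    (Γ : Measure (Metric.sphere (0 : EuclideanSpace ℝ ι) 1)) : Prop :=
  ∀ θ : EuclideanSpace ℝ ι,
    charFun μ θ = Complex.exp (-((∫ s, |⟪(s : EuclideanSpace ℝ ι), θ⟫| ^ α ∂Γ : ℝ) : ℂ))

/-- The sets `A` on which a random measure with control measure `K` is defined. -/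
def finiteSets {d : ℕ} {S : Type*} [MeasurableSpace S] (K : Measure (Vec d × S)) :
    Set (Set (Vec d)) :=
  {A | MeasurableSet A ∧ K (A ×ˢ Set.univ) < ∞}

/-- `M` is an `ℝ^ι`-valued symmetric `α`-stable random measure on `ℝ^d` with control measure `K`,
on the probability space `(Ω, P)`. The values of `M` outside `finiteSets K` are irrelevant. -/
structure IsStableRandomMeasure {d : ℕ} {ι : Type*} [Fintype ι] {Ω : Type*} [MeasurableSpace Ω]
    (α : ℝ) (K : Measure (Vec d × Metric.sphere (0 : EuclideanSpace ℝ ι) 1)) (P : Measure Ω)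
    (M : Set (Vec d) → Ω → EuclideanSpace ℝ ι) : Prop where
  measurable : ∀ A ∈ finiteSets K, Measurable (M A)
  independently_scattered : ∀ (k : ℕ) (A : Fin k → Set (Vec d)), (∀ j, A j ∈ finiteSets K) →
    Pairwise (fun i j => Disjoint (A i) (A j)) → iIndepFun (fun j => M (A j)) P
  sigma_additive : ∀ A : ℕ → Set (Vec d), (∀ j, A j ∈ finiteSets K) →
    Pairwise (fun i j => Disjoint (A i) (A j)) → (⋃ j, A j) ∈ finiteSets K →
    ∀ᵐ ω ∂P, Tendsto (fun n => ∑ j ∈ Finset.range n, M (A j) ω) atTop (𝓝 (M (⋃ j, A j) ω))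
  spectral : ∀ A ∈ finiteSets K,
    HasSpectralMeasure α (P.map (M A)) (K.restrict (A ×ˢ Set.univ)).snd

/-- The uniform measure on the unit sphere of `ℝ^ι`, multiplied by the constant for which
`∫ |⟨s, θ⟩| ^ α Γ(ds) = |θ| ^ α` for every `θ` (see `integral_uniformSphere`). -/
def uniformSphere (ι : Type*) [Fintype ι] (α : ℝ) :
    Measure (Metric.sphere (0 : EuclideanSpace ℝ ι) 1) :=
  ENNReal.ofReal (Fintype.card ι /
      ∫ s, ∑ i, |(s : EuclideanSpace ℝ ι) i| ^ α
        ∂(volume : Measure (EuclideanSpace ℝ ι)).toSphere) •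
    (volume : Measure (EuclideanSpace ℝ ι)).toSphere

section

open scoped Pointwise

/-- The surface measure of the unit sphere is invariant under linear isometries. -/
theorem map_toSphere {ι : Type*} [Fintype ι]
    (R : EuclideanSpace ℝ ι ≃ₗᵢ[ℝ] EuclideanSpace ℝ ι)
    (g : Metric.sphere (0 : EuclideanSpace ℝ ι) 1 → Metric.sphere (0 : EuclideanSpace ℝ ι) 1)
    (hg : ∀ s, (g s : EuclideanSpace ℝ ι) = R s) (hgm : Measurable g) :
    (volume : Measure (EuclideanSpace ℝ ι)).toSphere.map g =
      (volume : Measure (EuclideanSpace ℝ ι)).toSphere := by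
  ext s hs
  rw [Measure.map_apply hgm hs, Measure.toSphere_apply' _ (hgm hs), Measure.toSphere_apply' _ hs]
  congr 1
  have key : Set.Ioo (0 : ℝ) 1 • ((↑) '' (g ⁻¹' s) : Set (EuclideanSpace ℝ ι)) =
      R.toMeasurableEquiv ⁻¹' (Set.Ioo (0 : ℝ) 1 • ((↑) '' s : Set (EuclideanSpace ℝ ι))) := by
    ext x
    simp only [Set.mem_smul, Set.mem_image, Set.mem_preimage]
    constructor
    · rintro ⟨t, ht, _, ⟨u, hu, rfl⟩, rfl⟩
      exact ⟨t, ht, _, ⟨g u, hu, rfl⟩, by simp [hg]⟩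
    · rintro ⟨t, ht, _, ⟨u, hu, rfl⟩, hx⟩
      have hn : ‖R.symm (u : EuclideanSpace ℝ ι)‖ = 1 := by simp
      refine ⟨t, ht, R.symm u, ⟨⟨R.symm u, by simp⟩, ?_, rfl⟩, ?_⟩
      · have : g ⟨R.symm u, by simp⟩ = u := by
          apply Subtype.ext; rw [hg]; simp
        rw [this]; exact hu
      · apply R.injective
        simpa using hx
  rw [key]
  exact R.measurePreserving.measure_preimage_equiv _

end

/-- The normalization of `uniformSphere`. -/
theorem integral_uniformSphere {ι : Type*} [Fintype ι] {α : ℝ} (hα : 0 < α)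
    (θ : EuclideanSpace ℝ ι) :
    ∫ s, |⟪(s : EuclideanSpace ℝ ι), θ⟫| ^ α ∂(uniformSphere ι α) = ‖θ‖ ^ α := by
  classical
  set σ := (volume : Measure (EuclideanSpace ℝ ι)).toSphere with hσ
  let J : EuclideanSpace ℝ ι → ℝ := fun η => ∫ s, |⟪(s : EuclideanSpace ℝ ι), η⟫| ^ α ∂σ
  have hcont : ∀ η : EuclideanSpace ℝ ι, Continuous
      fun s : Metric.sphere (0 : EuclideanSpace ℝ ι) 1 =>
        |⟪(s : EuclideanSpace ℝ ι), η⟫| ^ α := fun η =>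
    Continuous.rpow_const (by fun_prop) fun _ => Or.inr hα.le
  have hint : ∀ η : EuclideanSpace ℝ ι, Integrable
      (fun s : Metric.sphere (0 : EuclideanSpace ℝ ι) 1 =>
        |⟪(s : EuclideanSpace ℝ ι), η⟫| ^ α) σ := fun η =>
    (hcont η).integrable_of_hasCompactSupport (HasCompactSupport.of_compactSpace _)
  have hrot : ∀ η η' : EuclideanSpace ℝ ι, ‖η‖ = ‖η'‖ → J η = J η' := by
    intro η η' h
    let R : EuclideanSpace ℝ ι ≃ₗᵢ[ℝ] EuclideanSpace ℝ ι := (ℝ ∙ (η - η'))ᗮ.reflection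
    have hR : R η = η' := Submodule.reflection_sub h
    let g : Metric.sphere (0 : EuclideanSpace ℝ ι) 1 → Metric.sphere (0 : EuclideanSpace ℝ ι) 1 :=
      fun s => ⟨R s, by simp⟩
    have hgm : Measurable g :=
      (Continuous.subtype_mk (R.continuous.comp continuous_subtype_val) _).measurable
    have hmap := map_toSphere R g (fun _ => rfl) hgm
    calc J η = ∫ s, |⟪(g s : EuclideanSpace ℝ ι), η'⟫| ^ α ∂σ := by
          refine integral_congr_ae (Eventually.of_forall fun s => ?_)
          simp only [g, ← hR, LinearIsometryEquiv.inner_map_map]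
      _ = ∫ s, |⟪(s : EuclideanSpace ℝ ι), η'⟫| ^ α ∂(σ.map g) :=
          (integral_map hgm.aemeasurable (hcont η').aestronglyMeasurable).symm
      _ = J η' := by rw [hmap]
  have hhom : ∀ (r : ℝ) (η : EuclideanSpace ℝ ι), 0 ≤ r → J (r • η) = r ^ α * J η := by
    intro r η hr
    simp only [J, ← integral_const_mul]
    refine integral_congr_ae (Eventually.of_forall fun s => ?_)
    simp only [inner_smul_right, abs_mul, abs_of_nonneg hr]
    exact Real.mul_rpow hr (abs_nonneg _)
  rcases isEmpty_or_nonempty ι with hι | ⟨⟨i₀⟩⟩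
  · have : θ = 0 := Subsingleton.elim _ _
    subst this
    simp [hα.ne']
  have hpos : 0 < J (EuclideanSpace.single i₀ 1) := by
    refine (hcont _).integral_pos_of_hasCompactSupport_nonneg_nonzero
      (HasCompactSupport.of_compactSpace _) (fun s => by positivity)
      (x := ⟨EuclideanSpace.single i₀ 1, by simp⟩) ?_
    simp
  have hsum : ∫ s, ∑ i, |(s : EuclideanSpace ℝ ι) i| ^ α ∂σ =
      Fintype.card ι * J (EuclideanSpace.single i₀ 1) := by
    have : ∀ i, ∫ s, |(s : EuclideanSpace ℝ ι) i| ^ α ∂σ = J (EuclideanSpace.single i₀ 1) := by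
      intro i
      rw [hrot (EuclideanSpace.single i₀ 1) (EuclideanSpace.single i 1) (by simp)]
      simp [J, EuclideanSpace.inner_single_right]
    rw [integral_finsetSum]
    · simp [this]
    · intro i _
      simpa [EuclideanSpace.inner_single_right] using hint (EuclideanSpace.single i 1)
  have hθ : J θ = ‖θ‖ ^ α * J (EuclideanSpace.single i₀ 1) := by
    rw [← hhom _ _ (norm_nonneg θ)]
    exact hrot _ _ (by simp [norm_smul])
  have : Nonempty ι := ⟨i₀⟩
  have hcard : (0 : ℝ) < Fintype.card ι := by exact_mod_cast Fintype.card_pos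
  rw [uniformSphere, integral_smul_measure, ← hσ, hsum, ENNReal.toReal_ofReal (by positivity)]
  change _ • J θ = _
  rw [hθ, smul_eq_mul]
  field_simp

/-- The control measure: Lebesgue measure times the normalized uniform measure. -/
def controlMeasure (d : ℕ) (ι : Type*) [Fintype ι] (α : ℝ) :
    Measure (Vec d × Metric.sphere (0 : EuclideanSpace ℝ ι) 1) :=
  (volume : Measure (Vec d)).prod (uniformSphere ι α)

/-! ### Complex random measure and stochastic integrals

An `ℝ^{2m}`-valued random measure is indexed by `Fin m ⊕ Fin m`: the first `m` coordinates are
the real parts and the last `m` coordinates are the imaginary parts of a `ℂ^m`-valued one. -/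

/-- The `ℂ^m`-valued random measure with real and imaginary parts given by `M`. -/
def complexMeasure {d m : ℕ} {Ω : Type*} (M : Set (Vec d) → Ω → EuclideanSpace ℝ (Fin m ⊕ Fin m))
    (A : Set (Vec d)) (ω : Ω) : Fin m → ℂ :=
  fun k => (M A ω (Sum.inl k) : ℂ) + Complex.I * (M A ω (Sum.inr k) : ℂ)

/-- `Re ∫ f dM̃ = Re ∑_C C M̃(f = C)` for a simple function `f` with complex matrix values. -/
def reSimpleIntegral {d m : ℕ} {Ω : Type*}
    (M : Set (Vec d) → Ω → EuclideanSpace ℝ (Fin m ⊕ Fin m))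
    (f : SimpleFunc (Vec d) (Matrix (Fin m) (Fin m) ℂ)) (ω : Ω) : Vec m :=
  WithLp.toLp 2 fun k => ((∑ C ∈ f.range, C *ᵥ complexMeasure M (f ⁻¹' {C}) ω) k).re

/-- `∫ (‖Re Q(u)‖ ^ α + ‖Im Q(u)‖ ^ α) du`, with operator norms. -/
def alphaSize {d m : ℕ} (α : ℝ) (Q : Vec d → Matrix (Fin m) (Fin m) ℂ) : ℝ≥0∞ :=
  ∫⁻ u, (‖op ((Q u).map Complex.re)‖ₑ ^ α + ‖op ((Q u).map Complex.im)‖ₑ ^ α)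

/-- The integrands for which the stochastic integral is defined. -/
def IsIntegrand {d m : ℕ} (α : ℝ) (Q : Vec d → Matrix (Fin m) (Fin m) ℂ) : Prop :=
  (∀ i j, Measurable fun u => Q u i j) ∧ alphaSize α Q < ∞

/-- The random vector `X` is (a version of) the stochastic integral `Re ∫ Q dM̃`: for every
sequence of simple functions (supported on sets of finite measure) approximating `Q` in the
`α`-th mean, the integrals of the simple functions converge to `X` in probability. -/
structure IsReIntegral {d m : ℕ} {Ω : Type*} [MeasurableSpace Ω] (α : ℝ) (P : Measure Ω)
    (M : Set (Vec d) → Ω → EuclideanSpace ℝ (Fin m ⊕ Fin m))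
    (Q : Vec d → Matrix (Fin m) (Fin m) ℂ) (X : Ω → Vec m) : Prop where
  integrand : IsIntegrand α Q
  measurable : Measurable X
  tendsto : ∀ f : ℕ → SimpleFunc (Vec d) (Matrix (Fin m) (Fin m) ℂ),
    (∀ n, (f n).FinMeasSupp volume) →
    Tendsto (fun n => alphaSize α fun u => Q u - f n u) atTop (𝓝 0) →
    TendstoInMeasure P (fun n => reSimpleIntegral M (f n)) atTop X

/-! ### Random fields -/

section Fields

variable {d m : ℕ} {Ω : Type*} [MeasurableSpace Ω]

/-- Equality of all finite-dimensional distributions. -/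
def SameFDD (P : Measure Ω) (X Y : Vec d → Ω → Vec m) : Prop :=
  ∀ (k : ℕ) (t : Fin k → Vec d),
    IdentDistrib (fun ω j => X (t j) ω) (fun ω j => Y (t j) ω) P P

/-- Continuity in probability at every point. -/
def StochasticallyContinuous (P : Measure Ω) (X : Vec d → Ω → Vec m) : Prop :=
  ∀ t₀ : Vec d, TendstoInMeasure P X (𝓝 t₀) (X t₀)

/-- A law is full if its support is not contained in any proper (affine) hyperplane. -/
def IsFull (μ : Measure (Vec m)) : Prop :=
  ∀ θ : Vec m, θ ≠ 0 → ∀ c : ℝ, ¬ μ.support ⊆ {x | ⟪θ, x⟫ = c}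

/-- The law of `X(t)` is full for every `t ≠ 0`. -/
def IsProper (P : Measure Ω) (X : Vec d → Ω → Vec m) : Prop :=
  ∀ t : Vec d, t ≠ 0 → IsFull (P.map (X t))

/-- `(E, D)`-operator-self-similarity:
`{X(r ^ E t), t ∈ ℝ^d}` and `{r ^ D X(t), t ∈ ℝ^d}` agree in law for every `r > 0`. -/
def IsOperatorSelfSimilar (E : Matrix (Fin d) (Fin d) ℝ) (D : Matrix (Fin m) (Fin m) ℝ)
    (P : Measure Ω) (X : Vec d → Ω → Vec m) : Prop :=
  ∀ r : ℝ, 0 < r →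
    SameFDD P (fun t => X (op (opPow r E) t)) (fun t ω => op (opPow r D) (X t ω))

/-- All finite-dimensional distributions are symmetric `α`-stable. -/
def IsSymmetricStableField (α : ℝ) (P : Measure Ω) (X : Vec d → Ω → Vec m) : Prop :=
  (∀ t, Measurable (X t)) ∧ ∀ (k : ℕ) (t : Fin k → Vec d),
    IsSymmetricStable α (P.map (fun ω (j : Fin k) => X (t j) ω))

/-- `{X(t + h) - X(h), t ∈ ℝ^d}` and `{X(t) - X(0), t ∈ ℝ^d}` agree in law for every `h`. -/
def HasStationaryIncrements (P : Measure Ω) (X : Vec d → Ω → Vec m) : Prop :=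
  ∀ h : Vec d, SameFDD P (fun t ω => X (t + h) ω - X h ω) (fun t ω => X t ω - X 0 ω)

end Fields

/-- The harmonizable kernel `y ↦ (e^{i⟨x, y⟩} - 1) ψ(y) ^ (-D - (q/α) I)`, `q = trace E`.
(At the single point `y = 0` the first factor vanishes.) -/
def harmonizableKernel {d m : ℕ} (α : ℝ) (E : Matrix (Fin d) (Fin d) ℝ)
    (D : Matrix (Fin m) (Fin m) ℝ) (ψ : Vec d → ℝ) (x y : Vec d) :
    Matrix (Fin m) (Fin m) ℂ :=
  (Complex.exp (Complex.I * ((⟪x, y⟫ : ℝ) : ℂ)) - 1) •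
    (opPow (ψ y) (-D - (E.trace / α) • (1 : Matrix (Fin m) (Fin m) ℝ))).map
      (fun t : ℝ => (t : ℂ))

end StableField

end

open StableField

namespace StableField

/-! Everything is read off one formula. Since the spectral measure on the sphere is rotation
invariant, `M A` has characteristic function `exp (-λ(A) ‖θ‖ ^ α)`. By independence over a common
refinement, a linear functional of finitely many simple integrals has characteristic function `exp
(-∫ ‖v(u)‖ ^ α du)`, where `v(u)` is the vector of coefficients (`coef`, `jointSize`). Under `ℝ^{2m}
≅ ℂ^m` the norm of `v` is Hermitian, so a complex factor `c` in the kernel only contributes `|c|`.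

The formula yields a tail bound: the integrals of `f` and `g` differ by `ε` with probability at most
`C ∫ ‖f - g‖ ^ α`. Hence integrals of an approximating sequence are Cauchy in probability and the
limit does not depend on the sequence. The formula survives the limit
(`HasJointCharFun.of_isReIntegral`).

The kernel is admissible because of a count over the shells `e^k < ψ ≤ e^(k+1)`, whose volume is
proportional to `e^(kq)`. There `ψ ^ (-q/α)` has size `e^(-kq/α)`, which cancels the volume after
taking `α`-th powers. What remains decays in `|k|`: for `k → ∞` because `ψ ^ (-D)` decays, for `k →
-∞` because `|e^{i⟨x,y⟩} - 1| ≤ ‖x‖ ‖y‖` decays at a rate arbitrarily close to `a₁`, which beats the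
growth of `ψ ^ (-D)` at a rate close to `H < a₁` (`exists_kernelBound_le`).

The five properties then concern `jointSize` alone. It is `α`-homogeneous in `θ`, which gives
stability. It is controlled by dominated convergence, which gives continuity in probability. It is
nonzero because the kernel is invertible on an open strip, so the laws are full. The substitution `y
= r^{-E*} z` gives self-similarity. Increments multiply the kernel by the phase `e^{i⟨h,y⟩}`, which
the norm does not see, so they are stationary. -/

lemma exists_norm_map_le {E F : Type*} [NormedAddCommGroup E] [NormedSpace ℝ E]
    [FiniteDimensional ℝ E] [NormedAddCommGroup F] [NormedSpace ℝ F] (f : E →ₗ[ℝ] F) :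
    ∃ K : ℝ, 0 ≤ K ∧ ∀ x, ‖f x‖ ≤ K * ‖x‖ :=
  ⟨‖LinearMap.toContinuousLinearMap f‖, norm_nonneg _,
    (LinearMap.toContinuousLinearMap f).le_opNorm⟩

/-! ### Determinant, spectrum and growth of matrix exponentials -/

section MatrixExponential

open NormedSpace

attribute [local instance] Matrix.linftyOpNormedAddCommGroup Matrix.linftyOpNormedSpace
  Matrix.linftyOpNormedRing Matrix.linftyOpNormedAlgebra

variable {n : ℕ}

lemma differentiable_det : Differentiable ℝ (fun A : Matrix (Fin n) (Fin n) ℝ => A.det) := by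
  have h : ∀ i j, Differentiable ℝ fun A : Matrix (Fin n) (Fin n) ℝ => A i j := fun i j =>
    (LinearMap.toContinuousLinearMap (Matrix.entryLinearMap ℝ ℝ i j)).differentiable
  simp only [Matrix.det_apply]
  fun_prop

/-- The linear coefficient of the polynomial `det (1 + tA)` is the trace; the remainder is divisible
by `t ^ 2`. -/
lemma fderiv_det_one (A : Matrix (Fin n) (Fin n) ℝ) :
    fderiv ℝ (fun B : Matrix (Fin n) (Fin n) ℝ => B.det) 1 A = A.trace := by
  have h1 : HasDerivAt (fun t : ℝ => (1 + t • A)) A 0 := by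
    have h := ((hasDerivAt_id (0 : ℝ)).smul_const A).const_add 1
    rw [one_smul] at h
    exact h
  have h2 : HasFDerivAt (fun B : Matrix (Fin n) (Fin n) ℝ => B.det)
      (fderiv ℝ (fun B : Matrix (Fin n) (Fin n) ℝ => B.det) 1) (1 + (0 : ℝ) • A) := by
    simpa using (differentiable_det (n := n) 1).hasFDerivAt
  have h3 := h2.comp_hasDerivAt (0 : ℝ) h1
  have h4 : HasDerivAt (fun t : ℝ => (1 + t • A).det) A.trace 0 := by
    simp_rw +singlePass [Matrix.det_one_add_smul]
    set p := (Matrix.det (1 + (Polynomial.X : Polynomial ℝ) • A.map Polynomial.C)).divX.divX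
    have h5 := (((hasDerivAt_id (0 : ℝ)).const_mul A.trace).const_add 1).add
      ((p.hasDerivAt 0).mul (hasDerivAt_pow 2 (0 : ℝ)))
    convert! h5 using 1
    simp
  exact h3.unique h4

/-- Both sides solve `f' = f · tr A` with `f 0 = 1`, so their quotient is constant. This supplies
the Jacobian of `r ^ A`. -/
lemma det_exp_smul (A : Matrix (Fin n) (Fin n) ℝ) (t : ℝ) :
    (exp (t • A)).det = Real.exp (t * A.trace) := by
  have hadd : ∀ s t : ℝ, exp ((s + t) • A) = exp (s • A) * exp (t • A) := fun s t => by
    rw [add_smul, Matrix.exp_add_of_commute _ _ ((Commute.refl A).smul_left s |>.smul_right t)]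
  have h0 : HasDerivAt (fun s : ℝ => (exp (s • A)).det) A.trace 0 := by
    have h1 : HasDerivAt (fun s : ℝ => exp (s • A)) A 0 := by
      have h := hasDerivAt_exp_smul_const (𝕂 := ℝ) A 0
      rw [zero_smul, NormedSpace.exp_zero, one_mul] at h
      exact h
    have h2 : HasFDerivAt (fun B : Matrix (Fin n) (Fin n) ℝ => B.det)
        (fderiv ℝ (fun B : Matrix (Fin n) (Fin n) ℝ => B.det) 1) (exp ((0 : ℝ) • A)) := by
      simpa using (differentiable_det (n := n) 1).hasFDerivAt
    have h3 := h2.comp_hasDerivAt (0 : ℝ) h1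
    exact (fderiv_det_one A) ▸ h3
  have hd : ∀ s : ℝ, HasDerivAt (fun s : ℝ => (exp (s • A)).det)
      ((exp (s • A)).det * A.trace) s := by
    intro s
    have h1 : HasDerivAt (fun u : ℝ => (exp ((u - s) • A)).det) A.trace s := by
      refine HasDerivAt.comp_sub_const (f := fun v : ℝ => (exp (v • A)).det) s s ?_
      rw [sub_self]
      exact h0
    have h2 := h1.const_mul ((exp (s • A)).det)
    refine h2.congr_of_eventuallyEq (Eventually.of_forall fun u => ?_)
    simp only
    rw [← Matrix.det_mul, ← hadd]
    congr 3; ring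
  have hg : ∀ s : ℝ, HasDerivAt (fun s : ℝ => (exp (s • A)).det * Real.exp (-(s * A.trace))) 0 s := by
    intro s
    have h1 : HasDerivAt (fun s : ℝ => Real.exp (-(s * A.trace)))
        (Real.exp (-(s * A.trace)) * (-A.trace)) s := by
      have := ((hasDerivAt_id s).mul_const A.trace).neg.exp
      simpa using this
    convert! (hd s).mul h1 using 1
    ring
  have hc := is_const_of_deriv_eq_zero (fun s => (hg s).differentiableAt) (fun s => (hg s).deriv) t 0
  simp only [zero_smul, NormedSpace.exp_zero, Matrix.det_one, zero_mul, neg_zero, Real.exp_zero, one_mul] at hc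
  rw [Real.exp_neg] at hc
  field_simp at hc
  exact hc

/-- `B` commutes with `exp B`, hence preserves its `z`-eigenspace and has an eigenvector there. On
that vector the exponential series sums to the exponential of the eigenvalue of `B`. -/
lemma eq_exp_of_mem_spectrum_exp {B : Matrix (Fin n) (Fin n) ℂ} {z : ℂ}
    (hz : z ∈ spectrum ℂ (exp B)) : ∃ w ∈ spectrum ℂ B, z = Complex.exp w := by
  set f : Module.End ℂ (Fin n → ℂ) := Matrix.toLin' B
  set g : Module.End ℂ (Fin n → ℂ) := Matrix.toLin' (exp B)
  have hcomm : Commute f g := by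
    have h : Commute B (exp B) := (Commute.refl B).exp_right
    change f * g = g * f
    simp only [f, g, Module.End.mul_eq_comp, ← Matrix.toLin'_mul, h.eq]
  rw [← Matrix.spectrum_toLin', ← Module.End.hasEigenvalue_iff_mem_spectrum] at hz
  have hmaps : ∀ x ∈ g.eigenspace z, f x ∈ g.eigenspace z := fun x hx => by
    rw [Module.End.mem_eigenspace_iff] at hx ⊢
    rw [← Module.End.mul_apply, ← hcomm.eq, Module.End.mul_apply, hx, map_smul]
  have : Nontrivial (g.eigenspace z) := Submodule.nontrivial_iff_ne_bot.2 hz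
  obtain ⟨w, hw⟩ := Module.End.exists_eigenvalue (f.restrict hmaps)
  obtain ⟨⟨v, hv⟩, hvw⟩ := hw.exists_hasEigenvector
  have hv0 : v ≠ 0 := fun h => hvw.2 (Subtype.ext h)
  have hfv : f v = w • v := congrArg Subtype.val hvw.apply_eq_smul
  have hgv : g v = z • v := Module.End.mem_eigenspace_iff.1 hv
  refine ⟨w, ?_, ?_⟩
  · rw [← Matrix.spectrum_toLin', ← Module.End.hasEigenvalue_iff_mem_spectrum]
    exact Module.End.hasEigenvalue_of_hasEigenvector ⟨Module.End.mem_eigenspace_iff.2 hfv, hv0⟩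
  · have hpow : ∀ k : ℕ, (B ^ k) *ᵥ v = w ^ k • v := by
      intro k
      induction k with
      | zero => simp
      | succ k ih =>
        have hBv : B *ᵥ v = w • v := hfv
        rw [pow_succ, ← Matrix.mulVec_mulVec, hBv, Matrix.mulVec_smul, ih, smul_smul, pow_succ,
          mul_comm]
    have hs : HasSum (fun k : ℕ => ((k.factorial : ℂ)⁻¹ • B ^ k) *ᵥ v) (exp B *ᵥ v) := by
      have h1 : HasSum (fun k : ℕ => (k.factorial : ℂ)⁻¹ • B ^ k) (exp B) :=
        NormedSpace.exp_series_hasSum_exp' (𝕂 := ℂ) B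
      let T : Matrix (Fin n) (Fin n) ℂ →ₗ[ℂ] (Fin n → ℂ) :=
        { toFun := fun C => C *ᵥ v
          map_add' := fun C C' => Matrix.add_mulVec C C' v
          map_smul' := fun c C => Matrix.smul_mulVec c C v }
      exact h1.mapL (LinearMap.toContinuousLinearMap T)
    have hs2 : HasSum (fun k : ℕ => ((k.factorial : ℂ)⁻¹ • B ^ k) *ᵥ v) (Complex.exp w • v) := by
      have h1 : HasSum (fun k : ℕ => (k.factorial : ℂ)⁻¹ • w ^ k) (Complex.exp w) := by
        rw [Complex.exp_eq_exp_ℂ]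
        exact NormedSpace.exp_series_hasSum_exp' (𝕂 := ℂ) w
      convert! h1.smul_const v using 2 with k
      rw [Matrix.smul_mulVec, hpow, smul_assoc]
    have h3 : exp B *ᵥ v = z • v := hgv
    have h4 := hs.unique hs2
    rw [h3] at h4
    exact smul_left_injective ℂ hv0 h4

lemma norm_lt_of_mem_spectrum_exp {A : Matrix (Fin n) (Fin n) ℝ} {h : ℝ}
    (hA : ∀ z ∈ eigenvalues A, z.re < h) {z : ℂ}
    (hz : z ∈ spectrum ℂ (exp (A.map (fun t : ℝ => (t : ℂ))))) : ‖z‖ < Real.exp h := by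
  obtain ⟨w, hw, rfl⟩ := eq_exp_of_mem_spectrum_exp hz
  rw [Complex.norm_exp]
  exact Real.exp_lt_exp.2 (hA w hw)

/-- Gelfand's formula: the spectral radius of `exp A` is below `e^h`, so its `k`-th power is
eventually at most `e^(kh)`. The constant absorbs the finitely many earlier powers and the passage
from the row-sum norm of the complexification to the Euclidean operator norm. -/
lemma exists_norm_exp_le [NeZero n] {A : Matrix (Fin n) (Fin n) ℝ} {h : ℝ}
    (hA : ∀ z ∈ eigenvalues A, z.re < h) :
    ∃ C : ℝ, ∀ k : ℕ, ‖op (exp ((k : ℝ) • A))‖ ≤ C * Real.exp (k * h) := by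
  set B := A.map (fun t : ℝ => (t : ℂ)) with hB
  have hmap : ∀ k : ℕ, (exp ((k : ℝ) • A)).map (fun t : ℝ => (t : ℂ)) = exp B ^ k := by
    intro k
    rw [← Matrix.exp_nsmul, ← Nat.cast_smul_eq_nsmul ℝ k B]
    have hc : Continuous (Complex.ofRealHom.mapMatrix (m := Fin n)) :=
      continuous_id.matrix_map Complex.continuous_ofReal
    have h1 := NormedSpace.map_exp (Complex.ofRealHom.mapMatrix (m := Fin n)) hc ((k : ℝ) • A)
    convert! h1 using 2
    ext i j
    simp [hB]
  have hnorm : ∀ M : Matrix (Fin n) (Fin n) ℝ, ‖M.map (fun t : ℝ => (t : ℂ))‖ = ‖M‖ := by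
    intro M
    simp [Matrix.linfty_opNorm_def]
  obtain ⟨K, hK, hT⟩ : ∃ K : ℝ, 0 ≤ K ∧ ∀ M : Matrix (Fin n) (Fin n) ℝ, ‖op M‖ ≤ K * ‖M‖ :=
    exists_norm_map_le (Matrix.toEuclideanCLM (n := Fin n) (𝕜 := ℝ)).toAlgEquiv.toLinearMap
  have hsr : spectralRadius ℂ (exp B) < (Real.toNNReal (Real.exp h) : ℝ≥0∞) := by
    refine spectrum.spectralRadius_lt_of_forall_lt _ fun z hz => ?_
    rw [← NNReal.coe_lt_coe, Real.coe_toNNReal _ (Real.exp_pos h).le]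
    exact norm_lt_of_mem_spectrum_exp hA hz
  have hev : ∀ᶠ k : ℕ in atTop, ‖exp B ^ k‖ ≤ Real.exp (k * h) := by
    have h1 := (spectrum.pow_nnnorm_pow_one_div_tendsto_nhds_spectralRadius (exp B)).eventually_lt_const
      hsr
    filter_upwards [h1, eventually_gt_atTop 0] with k hk hk0
    have hk0' : (0 : ℝ) < k := by exact_mod_cast hk0
    rw [← ENNReal.coe_rpow_of_nonneg _ (by positivity), ENNReal.coe_lt_coe, ← NNReal.coe_lt_coe,
      Real.coe_toNNReal _ (Real.exp_pos h).le, NNReal.coe_rpow, coe_nnnorm] at hk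
    have h2 := Real.rpow_le_rpow (by positivity) hk.le hk0'.le
    rw [← Real.rpow_mul (norm_nonneg _), one_div, inv_mul_cancel₀ hk0'.ne', Real.rpow_one,
      ← Real.exp_mul] at h2
    rwa [mul_comm]
  obtain ⟨N, hN⟩ := eventually_atTop.1 hev
  obtain ⟨C₀, hC₀⟩ := ((Set.finite_lt_nat N).image
    fun k : ℕ => ‖exp B ^ k‖ / Real.exp (k * h)).bddAbove
  refine ⟨K * max 1 C₀, fun k => ?_⟩
  refine (hT _).trans ?_
  rw [← hnorm, hmap, mul_assoc]
  refine mul_le_mul_of_nonneg_left ?_ hK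
  rcases lt_or_ge k N with hk | hk
  · have h1 : ‖exp B ^ k‖ / Real.exp (k * h) ≤ C₀ := hC₀ ⟨k, hk, rfl⟩
    rw [div_le_iff₀ (Real.exp_pos _)] at h1
    exact h1.trans (mul_le_mul_of_nonneg_right (le_max_right _ _) (Real.exp_pos _).le)
  · exact (hN k hk).trans (le_mul_of_one_le_left (Real.exp_pos _).le (le_max_left _ _))

lemma continuous_op_exp (A : Matrix (Fin n) (Fin n) ℝ) :
    Continuous fun t : ℝ => op (exp (t • A)) := by
  let T : Matrix (Fin n) (Fin n) ℝ →L[ℝ] (Vec n →L[ℝ] Vec n) :=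
    LinearMap.toContinuousLinearMap
      ((Matrix.toEuclideanCLM (n := Fin n) (𝕜 := ℝ)).toAlgEquiv.toLinearMap)
  have h1 : Continuous fun t : ℝ => exp (t • A) :=
    NormedSpace.exp_continuous.comp (continuous_id.smul continuous_const)
  exact T.continuous.comp h1

lemma continuous_exp_smul (A : Matrix (Fin n) (Fin n) ℝ) :
    Continuous fun t : ℝ => exp (t • A) :=
  NormedSpace.exp_continuous.comp (continuous_id.smul continuous_const)

lemma exp_smul_one (c : ℝ) : exp (c • (1 : Matrix (Fin n) (Fin n) ℝ)) = Real.exp c • 1 := by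
  have h : algebraMap ℝ (Matrix (Fin n) (Fin n) ℝ) (exp c) = exp (algebraMap ℝ _ c) :=
    NormedSpace.algebraMap_exp_comm c
  rw [← Algebra.algebraMap_eq_smul_one, ← h, Real.exp_eq_exp_ℝ, Algebra.algebraMap_eq_smul_one]

end MatrixExponential

/-! ### Algebra of the powers `r ^ A` -/

section OperatorPower

variable {n : ℕ}

lemma opPow_one (A : Matrix (Fin n) (Fin n) ℝ) : opPow 1 A = 1 := by
  simp [opPow]

lemma opPow_mul {r s : ℝ} (hr : 0 < r) (hs : 0 < s) (A : Matrix (Fin n) (Fin n) ℝ) :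
    opPow (r * s) A = opPow r A * opPow s A := by
  rw [opPow, Real.log_mul hr.ne' hs.ne', add_smul,
    Matrix.exp_add_of_commute _ _ (((Commute.refl A).smul_left _).smul_right _)]
  rfl

lemma opPow_mul_inv {r : ℝ} (hr : 0 < r) (A : Matrix (Fin n) (Fin n) ℝ) :
    opPow r A * opPow r⁻¹ A = 1 := by
  rw [← opPow_mul hr (inv_pos.2 hr), mul_inv_cancel₀ hr.ne', opPow_one]

lemma opPow_inv_mul {r : ℝ} (hr : 0 < r) (A : Matrix (Fin n) (Fin n) ℝ) :
    opPow r⁻¹ A * opPow r A = 1 := by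
  rw [← opPow_mul (inv_pos.2 hr) hr, inv_mul_cancel₀ hr.ne', opPow_one]

lemma det_opPow {r : ℝ} (hr : 0 < r) (A : Matrix (Fin n) (Fin n) ℝ) :
    (opPow r A).det = r ^ A.trace := by
  rw [opPow, det_exp_smul, Real.rpow_def_of_pos hr]

lemma opPow_transpose (r : ℝ) (A : Matrix (Fin n) (Fin n) ℝ) :
    opPow r Aᵀ = (opPow r A)ᵀ := by
  rw [opPow, opPow, ← Matrix.exp_transpose, Matrix.transpose_smul]

lemma opPow_neg (r : ℝ) (A : Matrix (Fin n) (Fin n) ℝ) : opPow r (-A) = opPow r⁻¹ A := by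
  simp [opPow]

lemma opPow_neg_sub_smul_one {r : ℝ} (hr : 0 < r) (A : Matrix (Fin n) (Fin n) ℝ) (c : ℝ) :
    opPow r (-A - c • 1) = r ^ (-c) • opPow r⁻¹ A := by
  have h : Real.log r • (-A - c • (1 : Matrix (Fin n) (Fin n) ℝ)) =
      Real.log r • (-A) + (Real.log r * (-c)) • 1 := by
    rw [sub_eq_add_neg, smul_add, mul_smul, neg_smul]
  rw [opPow, h, Matrix.exp_add_of_commute _ _ ((Commute.one_right _).smul_right _), exp_smul_one,
    Real.rpow_def_of_pos hr, mul_smul_comm, mul_one, ← opPow_neg]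
  rfl

lemma op_mul (A B : Matrix (Fin n) (Fin n) ℝ) : op (A * B) = op A * op B :=
  map_mul (Matrix.toEuclideanCLM (𝕜 := ℝ)) A B

lemma op_one : op (1 : Matrix (Fin n) (Fin n) ℝ) = 1 :=
  map_one (Matrix.toEuclideanCLM (𝕜 := ℝ))

lemma op_smul (c : ℝ) (A : Matrix (Fin n) (Fin n) ℝ) : op (c • A) = c • op A :=
  map_smul (Matrix.toEuclideanCLM (𝕜 := ℝ)) c A

lemma op_mul_apply (A B : Matrix (Fin n) (Fin n) ℝ) (x : Vec n) : op (A * B) x = op A (op B x) := by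
  rw [op_mul]; rfl

lemma op_transpose (A : Matrix (Fin n) (Fin n) ℝ) :
    op Aᵀ = ContinuousLinearMap.adjoint (op A) := by
  have h1 := map_star (Matrix.toEuclideanCLM (n := Fin n) (𝕜 := ℝ)) A
  rw [Matrix.star_eq_conjTranspose, Matrix.conjTranspose_eq_transpose_of_trivial] at h1
  exact h1

lemma inner_op_transpose (A : Matrix (Fin n) (Fin n) ℝ) (x y : Vec n) :
    ⟪x, op Aᵀ y⟫ = ⟪op A x, y⟫ := by
  rw [op_transpose, ContinuousLinearMap.adjoint_inner_right]

lemma norm_op_transpose (A : Matrix (Fin n) (Fin n) ℝ) : ‖op Aᵀ‖ = ‖op A‖ := by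
  rw [op_transpose]
  exact LinearIsometryEquiv.norm_map _ _

lemma det_op (A : Matrix (Fin n) (Fin n) ℝ) : LinearMap.det (op A : Vec n →ₗ[ℝ] Vec n) = A.det := by
  have h : (op A : Vec n →ₗ[ℝ] Vec n) =
      Matrix.toLin (PiLp.basisFun 2 ℝ (Fin n)) (PiLp.basisFun 2 ℝ (Fin n)) A := by
    rw [← Matrix.toLpLin_eq_toLin]
    rfl
  rw [h, LinearMap.det_toLin]

lemma exists_norm_opPow_le [NeZero n] {A : Matrix (Fin n) (Fin n) ℝ} {h : ℝ}
    (hA : ∀ z ∈ eigenvalues A, z.re < h) :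
    ∃ C : ℝ, 0 < C ∧ ∀ k : ℕ, ‖op (opPow (Real.exp k) A)‖ ≤ C * Real.exp (k * h) := by
  obtain ⟨C, hC⟩ := exists_norm_exp_le hA
  refine ⟨max C 1, by positivity, fun k => ?_⟩
  rw [opPow, Real.log_exp]
  exact (hC k).trans (mul_le_mul_of_nonneg_right (le_max_left _ _) (Real.exp_pos _).le)

lemma finite_eigenvalues (A : Matrix (Fin n) (Fin n) ℝ) : (eigenvalues A).Finite :=
  Matrix.finite_spectrum _

lemma re_le_maxRealPart {A : Matrix (Fin n) (Fin n) ℝ} {z : ℂ} (hz : z ∈ eigenvalues A) :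
    z.re ≤ maxRealPart A :=
  le_csSup ((finite_eigenvalues A).image _).bddAbove ⟨z, hz, rfl⟩

lemma minRealPart_le_re {A : Matrix (Fin n) (Fin n) ℝ} {z : ℂ} (hz : z ∈ eigenvalues A) :
    minRealPart A ≤ z.re :=
  csInf_le ((finite_eigenvalues A).image _).bddBelow ⟨z, hz, rfl⟩

lemma eigenvalues_neg (A : Matrix (Fin n) (Fin n) ℝ) : eigenvalues (-A) = -eigenvalues A := by
  rw [eigenvalues, eigenvalues, spectrum.neg_eq]
  congr 1
  ext; simp

end OperatorPower

/-! ### Homogeneous functions and their shells -/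

section HomogeneousFunctions

variable {d m : ℕ}

lemma lintegral_comp_op_opPow {r : ℝ} (hr : 0 < r) (A : Matrix (Fin d) (Fin d) ℝ)
    (f : Vec d → ℝ≥0∞) (hf : Measurable f) :
    ∫⁻ y, f (op (opPow r A) y) = ENNReal.ofReal (r ^ (-A.trace)) * ∫⁻ y, f y := by
  have hdet : LinearMap.det (op (opPow r A) : Vec d →ₗ[ℝ] Vec d) = r ^ A.trace := by
    rw [det_op, det_opPow hr]
  have h := Measure.map_linearMap_addHaar_eq_smul_addHaar (volume : Measure (Vec d))
    (f := (op (opPow r A) : Vec d →ₗ[ℝ] Vec d)) (by rw [hdet]; positivity)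
  rw [hdet, abs_of_pos (by positivity), ← Real.rpow_neg hr.le] at h
  rw [← smul_eq_mul, ← lintegral_smul_measure, ← h]
  exact (lintegral_map hf (op (opPow r A)).continuous.measurable).symm

lemma exists_lower_bound_of_isCompact {X : Type*} [TopologicalSpace X] {K : Set X}
    (hK : IsCompact K) {f : X → ℝ} (hf : Continuous f) (hpos : ∀ x ∈ K, 0 < f x) :
    ∃ c : ℝ, 0 < c ∧ ∀ x ∈ K, c ≤ f x := by
  rcases K.eq_empty_or_nonempty with rfl | hne
  · exact ⟨1, one_pos, by simp⟩
  · obtain ⟨x, hx, hmin⟩ := hK.exists_isMinOn hne hf.continuousOn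
    exact ⟨f x, hpos x hx, fun y hy => hmin hy⟩

/-- A positive function that is homogeneous for an expanding operator has bounded sublevel
sets. -/
lemma exists_norm_le_of_homogeneous {Θ : Matrix (Fin d) (Fin d) ℝ}
    {ψ : Vec d → ℝ} (hψ_cont : Continuous ψ) (hψ_pos : ∀ y, y ≠ 0 → 0 < ψ y)
    (hψ_hom : IsHomogeneous Θ ψ)
    (hdecay : Tendsto (fun n : ℕ => ‖op (opPow (Real.exp (-n)) Θ)‖) atTop (𝓝 0)) (c : ℝ) :
    ∃ R : ℝ, 0 < R ∧ ∀ y, ψ y ≤ c → ‖y‖ ≤ R := by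
  set A := op (opPow (Real.exp 1) Θ) with hA
  -- Contracting `y` by `e^{-nΘ}`, the first point of norm at most `1` lies in this shell: its
  -- predecessor, of norm above `1`, is its image under `A`. The `+ 1` keeps the inverse meaningful
  -- when `A = 0`.
  set K : Set (Vec d) := {z | ‖z‖ ≤ 1 ∧ (‖A‖ + 1)⁻¹ ≤ ‖z‖} with hK
  have hKc : IsCompact K := by
    refine (isCompact_closedBall (0 : Vec d) 1).of_isClosed_subset ?_ fun z hz => ?_
    · exact (isClosed_le continuous_norm continuous_const).inter
        (isClosed_le continuous_const continuous_norm)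
    · simpa using hz.1
  have hA1 : 0 < (‖A‖ + 1)⁻¹ := by positivity
  obtain ⟨b, hb, hbK⟩ := exists_lower_bound_of_isCompact hKc hψ_cont fun z hz =>
    hψ_pos z (norm_pos_iff.1 (hA1.trans_le hz.2))
  -- If `n` contractions are needed then `ψ y = e^n ψ (z n) ≥ n b`, so `ψ y ≤ c` forces `n < N`. The
  -- radius below adds the norms of all the expansions that can occur; its summand `1` covers `n =
  -- 0`.
  obtain ⟨N, hN⟩ := exists_nat_gt (c / b)
  set R : ℝ := 1 + ∑ k ∈ Finset.range (N + 1), ‖op (opPow (Real.exp k) Θ)‖ with hR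
  have hsum : 0 ≤ ∑ k ∈ Finset.range (N + 1), ‖op (opPow (Real.exp k) Θ)‖ :=
    Finset.sum_nonneg fun _ _ => norm_nonneg _
  refine ⟨R, by positivity, fun y hy => ?_⟩
  set z : ℕ → Vec d := fun n => op (opPow (Real.exp (-n)) Θ) y with hz
  have hzy : ∀ n : ℕ, op (opPow (Real.exp n) Θ) (z n) = y := fun n => by
    rw [hz]
    simp only
    rw [← op_mul_apply, Real.exp_neg, opPow_mul_inv (Real.exp_pos _), op_one]
    rfl
  have hz0 : z 0 = y := by
    have := hzy 0
    simpa [opPow_one, op_one] using this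
  have hex : ∃ n, ‖z n‖ ≤ 1 := by
    have h1 : Tendsto (fun n : ℕ => ‖op (opPow (Real.exp (-n)) Θ)‖ * ‖y‖) atTop (𝓝 0) := by
      simpa using hdecay.mul_const ‖y‖
    obtain ⟨n, hn⟩ := (h1.eventually_le_const one_pos).exists
    exact ⟨n, ((op (opPow (Real.exp (-n)) Θ)).le_opNorm y).trans hn⟩
  classical
  set n := Nat.find hex with hn
  have hn1 : ‖z n‖ ≤ 1 := Nat.find_spec hex
  rcases Nat.eq_zero_or_pos n with h0 | hpos
  · rw [h0, hz0] at hn1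
    linarith
  · have hprev : 1 < ‖z (n - 1)‖ := not_le.1 (Nat.find_min hex (by omega))
    have hstep : z (n - 1) = A (z n) := by
      have h1 : Real.exp (-((n - 1 : ℕ) : ℝ)) = Real.exp 1 * Real.exp (-n) := by
        rw [← Real.exp_add, Nat.cast_sub hpos]
        congr 1; push_cast; ring
      simp only [hz, hA]
      rw [h1, opPow_mul (Real.exp_pos _) (Real.exp_pos _), op_mul_apply]
    have hzK : z n ∈ K := by
      refine ⟨hn1, ?_⟩
      rw [inv_le_iff_one_le_mul₀ (by positivity)]
      have h1 : ‖z (n - 1)‖ ≤ ‖A‖ * ‖z n‖ := hstep ▸ A.le_opNorm _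
      nlinarith [norm_nonneg (z n)]
    have hzn0 : z n ≠ 0 := norm_pos_iff.1 (hA1.trans_le hzK.2)
    have hψy : ψ y = Real.exp n * ψ (z n) := by
      rw [← hψ_hom _ (Real.exp_pos _) _ hzn0, hzy]
    have hnN : n < N := by
      have h1 : (n : ℝ) * b ≤ c := by
        calc (n : ℝ) * b ≤ Real.exp n * ψ (z n) :=
              mul_le_mul (by linarith [Real.add_one_le_exp (n : ℝ)]) (hbK _ hzK) hb.le
                (Real.exp_pos _).le
          _ ≤ c := hψy ▸ hy
      have h2 : (n : ℝ) ≤ c / b := (le_div_iff₀ hb).2 h1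
      exact_mod_cast h2.trans_lt hN
    have h2 : ‖op (opPow (Real.exp n) Θ)‖ ≤
        ∑ k ∈ Finset.range (N + 1), ‖op (opPow (Real.exp k) Θ)‖ :=
      Finset.single_le_sum (f := fun k : ℕ => ‖op (opPow (Real.exp k) Θ)‖)
        (fun _ _ => norm_nonneg _) (Finset.mem_range.2 (by omega))
    calc ‖y‖ = ‖op (opPow (Real.exp n) Θ) (z n)‖ := by rw [hzy]
      _ ≤ ‖op (opPow (Real.exp n) Θ)‖ * ‖z n‖ := ContinuousLinearMap.le_opNorm _ _
      _ ≤ ‖op (opPow (Real.exp n) Θ)‖ * 1 := by gcongr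
      _ ≤ R := by linarith

/-- The shell `exp k < ψ ≤ exp (k + 1)`. -/
def shell (ψ : Vec d → ℝ) (k : ℤ) : Set (Vec d) := {y | Real.exp k < ψ y ∧ ψ y ≤ Real.exp (k + 1)}

lemma measurableSet_shell {ψ : Vec d → ℝ} (hψ : Continuous ψ) (k : ℤ) :
    MeasurableSet (shell ψ k) :=
  (measurableSet_lt measurable_const hψ.measurable).inter
    (measurableSet_le hψ.measurable measurable_const)

lemma op_opPow_ne_zero {r : ℝ} (hr : 0 < r) (Θ : Matrix (Fin d) (Fin d) ℝ) {y : Vec d}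
    (hy : y ≠ 0) : op (opPow r Θ) y ≠ 0 := by
  intro h
  apply hy
  have h1 : op (opPow r⁻¹ Θ) (op (opPow r Θ) y) = y := by
    rw [← op_mul_apply, opPow_inv_mul hr, op_one]; rfl
  rw [← h1, h, map_zero]

lemma mem_shell_iff {Θ : Matrix (Fin d) (Fin d) ℝ} {ψ : Vec d → ℝ}
    (hψ_hom : IsHomogeneous Θ ψ) {y : Vec d} (hy : y ≠ 0) (k : ℤ) :
    op (opPow (Real.exp k) Θ) y ∈ shell ψ k ↔ y ∈ shell ψ 0 := by
  simp only [shell, Set.mem_ofPred_eq, hψ_hom _ (Real.exp_pos _) y hy, Real.exp_add]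
  rw [lt_mul_iff_one_lt_right (Real.exp_pos _), mul_le_mul_iff_right₀ (Real.exp_pos _)]
  simp

/-- Away from the origin `e^{kΘ}` carries shell `0` onto shell `k`, with Jacobian `e^(k tr Θ)`. -/
lemma volume_shell [NeZero d] {Θ : Matrix (Fin d) (Fin d) ℝ} {ψ : Vec d → ℝ}
    (hψ_cont : Continuous ψ) (hψ_hom : IsHomogeneous Θ ψ) (k : ℤ) :
    volume (shell ψ k) = ENNReal.ofReal (Real.exp (k * Θ.trace)) * volume (shell ψ 0) := by
  have h1 := lintegral_comp_op_opPow (Real.exp_pos k) Θ ((shell ψ k).indicator 1)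
    (measurable_one.indicator (measurableSet_shell hψ_cont k))
  rw [lintegral_indicator_one (measurableSet_shell hψ_cont k)] at h1
  have h2 : ∫⁻ y, (shell ψ k).indicator (1 : Vec d → ℝ≥0∞) (op (opPow (Real.exp k) Θ) y) =
      volume (shell ψ 0) := by
    rw [← lintegral_indicator_one (measurableSet_shell hψ_cont 0)]
    have h0 : ∀ᵐ y : Vec d, y ≠ 0 := by simp [ae_iff]
    refine lintegral_congr_ae ?_
    filter_upwards [h0] with y hy
    by_cases h : y ∈ shell ψ 0
    · rw [Set.indicator_of_mem h, Set.indicator_of_mem ((mem_shell_iff hψ_hom hy k).2 h)]; rfl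
    · rw [Set.indicator_of_notMem h,
        Set.indicator_of_notMem (fun h' => h ((mem_shell_iff hψ_hom hy k).1 h'))]
  rw [h2] at h1
  rw [h1, ← mul_assoc, ← ENNReal.ofReal_mul (Real.exp_pos _).le, ← Real.exp_mul, ← Real.exp_add]
  simp

lemma exists_mem_shell {ψ : Vec d → ℝ} {y : Vec d} (hy : 0 < ψ y) : ∃ k : ℤ, y ∈ shell ψ k := by
  refine ⟨⌈Real.log (ψ y)⌉ - 1, ?_, ?_⟩
  · rw [← Real.lt_log_iff_exp_lt hy]
    push_cast
    linarith [Int.ceil_lt_add_one (Real.log (ψ y))]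
  · rw [← Real.log_le_iff_le_exp hy]
    push_cast
    linarith [Int.le_ceil (Real.log (ψ y))]

end HomogeneousFunctions

/-! ### Integrability of the kernel -/

section KernelBound

variable {d m : ℕ}

/-- A function dominating, up to a factor depending on `x`, the norm of the harmonizable
kernel. -/
noncomputable def kernelBound (α : ℝ) (E : Matrix (Fin d) (Fin d) ℝ) (D : Matrix (Fin m) (Fin m) ℝ)
    (ψ : Vec d → ℝ) (y : Vec d) : ℝ :=
  min 2 ‖y‖ * ‖op (opPow (ψ y) (-D - (E.trace / α) • (1 : Matrix (Fin m) (Fin m) ℝ)))‖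

/-- The gap `g` between the two spectra is cut into thirds: the rate `H` lies `g/3` above the
spectrum of `D`, and `H + δ` still stays `g/3` below that of `E`. The strict inequalities leave room
for exponential bounds. -/
lemma exists_spectral_gap {E : Matrix (Fin d) (Fin d) ℝ} {D : Matrix (Fin m) (Fin m) ℝ}
    (hD : D ∈ posOperators m) (hDE : maxRealPart D < minRealPart E) :
    ∃ δ H : ℝ, 0 < δ ∧ (∀ z ∈ eigenvalues D, δ < z.re) ∧ (∀ z ∈ eigenvalues D, z.re < H) ∧
      ∀ z ∈ eigenvalues E, H + δ < z.re := by
  obtain ⟨δ₁, hδ₁, h₁⟩ : ∃ δ₁ : ℝ, 0 < δ₁ ∧ ∀ z ∈ eigenvalues D, δ₁ < z.re := by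
    obtain ⟨c, hc, h⟩ := exists_lower_bound_of_isCompact (finite_eigenvalues D).isCompact
      Complex.continuous_re hD.2
    exact ⟨c / 2, by positivity, fun z hz => by linarith [h z hz]⟩
  set g := minRealPart E - maxRealPart D with hg
  have hg0 : 0 < g := sub_pos.2 hDE
  refine ⟨min δ₁ (g / 3), maxRealPart D + g / 3, by positivity, fun z hz => ?_, fun z hz => ?_,
    fun z hz => ?_⟩
  · exact (min_le_left _ _).trans_lt (h₁ z hz)
  · linarith [re_le_maxRealPart hz]
  · linarith [minRealPart_le_re hz, min_le_right δ₁ (g / 3)]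

lemma exists_norm_opPow_exp_neg_le [NeZero d] {A : Matrix (Fin d) (Fin d) ℝ} {h : ℝ}
    (hA : ∀ z ∈ eigenvalues A, h < z.re) :
    ∃ C : ℝ, 0 < C ∧ ∀ k : ℕ, ‖op (opPow (Real.exp (-k)) A)‖ ≤ C * Real.exp (-(k * h)) := by
  obtain ⟨C, hC, hb⟩ := exists_norm_opPow_le (A := -A) (h := -h) fun z hz => by
    rw [eigenvalues_neg, Set.mem_neg] at hz
    have := hA _ hz
    simp at this
    linarith
  refine ⟨C, hC, fun k => ?_⟩
  have := hb k
  rwa [opPow_neg, ← Real.exp_neg, mul_neg] at this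

/-- On shell `k`, up to bounded factors, `ψ ^ (-D)` is `e^{-kD}` and `ψ ^ (-q/α)` is `e^(-kq/α)`.
For `k ≥ 0` the norm of `e^{-kD}` is `O(e^(-kδ))`. For `k = -n`, `y = e^{-nE*} z` with `z` in the
bounded shell `0`, so `‖y‖ = O(e^(-n(H+δ)))`, which outweighs `‖e^{nD}‖ = O(e^(nH))`. -/
lemma exists_kernelBound_le [NeZero d] [NeZero m] {α : ℝ}
    {E : Matrix (Fin d) (Fin d) ℝ} {D : Matrix (Fin m) (Fin m) ℝ}
    (hE : E ∈ posOperators d) (hD : D ∈ posOperators m) (hDE : maxRealPart D < minRealPart E)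
    {ψ : Vec d → ℝ} (hψ_cont : Continuous ψ) (hψ_pos : ∀ y, y ≠ 0 → 0 < ψ y)
    (hψ_hom : IsHomogeneous Eᵀ ψ) :
    volume (shell ψ 0) < ∞ ∧ ∃ C δ : ℝ, 0 < C ∧ 0 < δ ∧ ∀ (k : ℤ) (y : Vec d), y ∈ shell ψ k →
      kernelBound α E D ψ y ≤
        C * Real.exp (-(k * (E.trace / α))) * Real.exp (-(δ * |(k : ℝ)|)) := by
  obtain ⟨δ, H, hδ, hDδ, hDH, hEδ⟩ := exists_spectral_gap hD hDE
  obtain ⟨C₁, hC₁, hb₁⟩ := exists_norm_opPow_exp_neg_le hDδ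
  obtain ⟨C₂, hC₂, hb₂⟩ := exists_norm_opPow_le hDH
  obtain ⟨C₃, hC₃, hb₃⟩ := exists_norm_opPow_exp_neg_le hEδ
  obtain ⟨a, ha, hEa⟩ := exists_lower_bound_of_isCompact (finite_eigenvalues E).isCompact
      Complex.continuous_re hE.2
  obtain ⟨C₄, hC₄, hb₄⟩ := exists_norm_opPow_exp_neg_le (A := E) (h := a / 2)
    fun z hz => by linarith [hEa z hz]
  have hdecay : Tendsto (fun n : ℕ => ‖op (opPow (Real.exp (-n)) Eᵀ)‖) atTop (𝓝 0) := by
    have h1 : Tendsto (fun n : ℕ => C₄ * Real.exp (-(n * (a / 2)))) atTop (𝓝 0) := by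
      have h2 : Tendsto (fun n : ℕ => (n : ℝ) * (a / 2)) atTop atTop :=
        tendsto_natCast_atTop_atTop.atTop_mul_const (by positivity)
      simpa using (Real.tendsto_exp_neg_atTop_nhds_zero.comp h2).const_mul C₄
    refine squeeze_zero (fun _ => norm_nonneg _) (fun n => ?_) h1
    rw [opPow_transpose, norm_op_transpose]
    exact hb₄ n
  obtain ⟨R, hR, hRb⟩ := exists_norm_le_of_homogeneous hψ_cont hψ_pos hψ_hom hdecay (Real.exp 1)
  -- `B` bounds `e^{-tD}` for `0 ≤ t ≤ 1`, the range of the fractional position `t = log (ψ y) - k`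
  -- inside a shell; the growth bounds above cover integer exponents only.
  obtain ⟨B, hB⟩ := (isCompact_Icc (a := (-1 : ℝ)) (b := 0)).exists_bound_of_continuousOn
    (continuous_op_exp D).continuousOn
  have hB0 : 0 ≤ B := (norm_nonneg _).trans (hB 0 (by simp))
  have hshell0 : shell ψ 0 ⊆ Metric.closedBall 0 R := fun y hy => by
    have h := hy.2
    simp only [Int.cast_zero, zero_add] at h
    simpa using hRb y h
  refine ⟨(measure_mono hshell0).trans_lt measure_closedBall_lt_top, ?_⟩
  set p := E.trace / α with hp
  set K : ℝ := Real.exp |p| * B with hK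
  have hfac : ∀ (k : ℤ) (y : Vec d), y ∈ shell ψ k →
      ‖op (opPow (ψ y) (-D - p • (1 : Matrix (Fin m) (Fin m) ℝ)))‖ ≤
        K * Real.exp (-(k * p)) * ‖op (opPow (Real.exp (-k)) D)‖ := by
    intro k y hy
    have hψy : 0 < ψ y := (Real.exp_pos _).trans hy.1
    set t := Real.log (ψ y) - k with ht
    have ht0 : 0 ≤ t := by
      have := (Real.lt_log_iff_exp_lt hψy).2 hy.1
      linarith
    have ht1 : t ≤ 1 := by
      have := (Real.log_le_iff_le_exp hψy).2 hy.2
      linarith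
    have hψe : (ψ y)⁻¹ = Real.exp (-k) * Real.exp (-t) := by
      rw [← Real.exp_add, ← Real.exp_log hψy, ← Real.exp_neg]
      congr 1
      rw [ht]; ring
    have hpow : ψ y ^ (-p) ≤ Real.exp (-(k * p)) * Real.exp |p| := by
      rw [Real.rpow_def_of_pos hψy, ← Real.exp_add]
      refine Real.exp_le_exp.2 ?_
      have h1 : Real.log (ψ y) = k + t := by rw [ht]; ring
      have h2 : -(t * p) ≤ |p| := by
        calc -(t * p) ≤ |t * p| := neg_le_abs _
          _ = t * |p| := by rw [abs_mul, abs_of_nonneg ht0]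
          _ ≤ 1 * |p| := by gcongr
          _ = |p| := one_mul _
      rw [h1]
      linarith
    rw [opPow_neg_sub_smul_one hψy, op_smul, norm_smul, Real.norm_of_nonneg (by positivity), hψe,
      opPow_mul (Real.exp_pos _) (Real.exp_pos _), op_mul]
    have h3 : ‖op (opPow (Real.exp (-t)) D)‖ ≤ B := by
      rw [opPow, Real.log_exp]
      exact hB (-t) ⟨by linarith, by linarith⟩
    calc ψ y ^ (-p) * ‖op (opPow (Real.exp (-k)) D) * op (opPow (Real.exp (-t)) D)‖
        ≤ (Real.exp (-(k * p)) * Real.exp |p|) * (‖op (opPow (Real.exp (-k)) D)‖ * B) := by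
          gcongr
          exact (norm_mul_le _ _).trans (by gcongr)
      _ = _ := by rw [hK]; ring
  have hK0 : 0 ≤ K := by positivity
  refine ⟨2 * K * C₁ + K * C₂ * C₃ * R + 1, δ, by positivity, hδ, fun k y hy => ?_⟩
  rw [kernelBound]
  have hmain : min 2 ‖y‖ * ‖op (opPow (Real.exp (-k)) D)‖ ≤
      (2 * C₁ + C₂ * C₃ * R) * Real.exp (-(δ * |(k : ℝ)|)) := by
    rcases le_total 0 k with hk | hk
    · lift k to ℕ using hk
      have h1 := hb₁ k
      simp only [Int.cast_natCast, Nat.abs_cast]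
      calc min 2 ‖y‖ * ‖op (opPow (Real.exp (-(k : ℝ))) D)‖
          ≤ 2 * (C₁ * Real.exp (-(k * δ))) := by
            gcongr
            exact min_le_left _ _
        _ ≤ 2 * (C₁ * Real.exp (-(k * δ))) + C₂ * C₃ * R * Real.exp (-(k * δ)) := by
            have : 0 ≤ C₂ * C₃ * R * Real.exp (-(k * δ)) := by positivity
            linarith
        _ = _ := by rw [mul_comm (k : ℝ) δ]; ring
    · obtain ⟨n, rfl⟩ : ∃ n : ℕ, k = -n := ⟨k.natAbs, by omega⟩
      simp only [Int.cast_neg, Int.cast_natCast, neg_neg, abs_neg, Nat.abs_cast]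
      rcases eq_or_ne y 0 with rfl | hy0
      · simp only [norm_zero, zero_le_two, min_eq_right, zero_mul]
        positivity
      set z := op (opPow (Real.exp n) Eᵀ) y with hz
      have hyz : op (opPow (Real.exp (-n)) Eᵀ) z = y := by
        rw [hz, ← op_mul_apply, Real.exp_neg, opPow_inv_mul (Real.exp_pos _), op_one]; rfl
      have hz0 : z ≠ 0 := op_opPow_ne_zero (Real.exp_pos _) _ hy0
      have hzs : z ∈ shell ψ 0 := by
        rw [← mem_shell_iff hψ_hom hz0 (-n)]
        simpa [hyz] using hy
      have hzR : ‖z‖ ≤ R := by simpa using hshell0 hzs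
      have hyn : ‖y‖ ≤ C₃ * Real.exp (-(n * (H + δ))) * R := by
        rw [← hyz]
        refine (ContinuousLinearMap.le_opNorm _ _).trans ?_
        rw [opPow_transpose, norm_op_transpose]
        exact mul_le_mul (hb₃ n) hzR (norm_nonneg _) (by positivity)
      calc min 2 ‖y‖ * ‖op (opPow (Real.exp n) D)‖
          ≤ (C₃ * Real.exp (-(n * (H + δ))) * R) * (C₂ * Real.exp (n * H)) := by
            gcongr
            · exact (min_le_right _ _).trans hyn
            · exact hb₂ n
        _ = C₂ * C₃ * R * (Real.exp (-(n * (H + δ))) * Real.exp (n * H)) := by ring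
        _ = C₂ * C₃ * R * Real.exp (-(δ * n)) := by
            rw [← Real.exp_add]; congr 2; ring
        _ ≤ _ := by
            have : 0 ≤ 2 * C₁ * Real.exp (-(δ * n)) := by positivity
            linarith
  calc min 2 ‖y‖ * ‖op (opPow (ψ y) (-D - p • (1 : Matrix (Fin m) (Fin m) ℝ)))‖
      ≤ min 2 ‖y‖ * (K * Real.exp (-(k * p)) * ‖op (opPow (Real.exp (-k)) D)‖) :=
        mul_le_mul_of_nonneg_left (hfac k y hy) (by positivity)
    _ = K * Real.exp (-(k * p)) * (min 2 ‖y‖ * ‖op (opPow (Real.exp (-k)) D)‖) := by ring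
    _ ≤ K * Real.exp (-(k * p)) * ((2 * C₁ + C₂ * C₃ * R) * Real.exp (-(δ * |(k : ℝ)|))) := by
        gcongr
    _ ≤ _ := by
        have : 0 ≤ Real.exp (-(k * p)) * Real.exp (-(δ * |(k : ℝ)|)) := by positivity
        nlinarith

/-- The shells cover all points but the origin. The `α`-th power of `e^(-kq/α)` cancels the volume
`e^(kq)` of shell `k`, leaving the two-sided geometric series of `e^(-δα|k|)`. -/
lemma lintegral_kernelBound_lt_top [NeZero d] [NeZero m] {α : ℝ} (hα : 0 < α)
    {E : Matrix (Fin d) (Fin d) ℝ} {D : Matrix (Fin m) (Fin m) ℝ}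
    (hE : E ∈ posOperators d) (hD : D ∈ posOperators m) (hDE : maxRealPart D < minRealPart E)
    {ψ : Vec d → ℝ} (hψ_cont : Continuous ψ) (hψ_pos : ∀ y, y ≠ 0 → 0 < ψ y)
    (hψ_hom : IsHomogeneous Eᵀ ψ) :
    ∫⁻ y, ENNReal.ofReal (kernelBound α E D ψ y) ^ α < ∞ := by
  obtain ⟨hvol, C, δ, hC, hδ, hb⟩ := exists_kernelBound_le (α := α) hE hD hDE hψ_cont hψ_pos hψ_hom
  have hU : ∫⁻ y, ENNReal.ofReal (kernelBound α E D ψ y) ^ α =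
      ∫⁻ y in ⋃ k : ℤ, shell ψ k, ENNReal.ofReal (kernelBound α E D ψ y) ^ α := by
    rw [setLIntegral_congr (t := Set.univ), setLIntegral_univ]
    have h0 : ∀ᵐ y : Vec d, y ≠ 0 := by simp [ae_iff]
    refine eventuallyEq_univ.2 ?_
    filter_upwards [h0] with y hy
    exact Set.mem_iUnion.2 (exists_mem_shell (hψ_pos y hy))
  rw [hU]
  refine (lintegral_iUnion_le _ _).trans_lt ?_
  have hk : ∀ k : ℤ, ∫⁻ y in shell ψ k, ENNReal.ofReal (kernelBound α E D ψ y) ^ α ≤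
      ENNReal.ofReal (C ^ α * Real.exp (-(δ * α * |(k : ℝ)|))) * volume (shell ψ 0) := by
    intro k
    have h1 : ∀ y ∈ shell ψ k, ENNReal.ofReal (kernelBound α E D ψ y) ^ α ≤
        ENNReal.ofReal ((C * Real.exp (-(k * (E.trace / α))) * Real.exp (-(δ * |(k : ℝ)|))) ^ α) := by
      intro y hy
      rw [← ENNReal.ofReal_rpow_of_nonneg (by positivity) hα.le]
      gcongr
      exact hb k y hy
    refine (setLIntegral_mono measurable_const h1).trans ?_
    rw [setLIntegral_const, volume_shell hψ_cont hψ_hom, ← mul_assoc,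
      ← ENNReal.ofReal_mul (by positivity), Matrix.trace_transpose]
    apply le_of_eq
    congr 2
    rw [Real.mul_rpow (by positivity) (by positivity), Real.mul_rpow hC.le (by positivity),
      ← Real.exp_mul, ← Real.exp_mul, mul_assoc, mul_assoc, ← Real.exp_add, ← Real.exp_add]
    congr 2
    field_simp
    ring
  refine (ENNReal.tsum_le_tsum hk).trans_lt ?_
  rw [ENNReal.tsum_mul_right]
  refine ENNReal.mul_lt_top ?_ hvol
  have hs : Summable fun k : ℤ => C ^ α * Real.exp (-(δ * α * |(k : ℝ)|)) := by
    refine Summable.mul_left _ ?_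
    have hn : Summable fun n : ℕ => Real.exp (-(δ * α * |(n : ℝ)|)) := by
      have := Real.summable_exp_nat_mul_iff (a := -(δ * α))
      simp only [Nat.abs_cast]
      convert! this.2 (by nlinarith [mul_pos hδ hα]) using 2 with n
      congr 1; ring
    exact Summable.of_nat_of_neg (by simpa using hn) (by simpa using hn)
  exact hs.tsum_ofReal_lt_top

end KernelBound

/-! ### Pairing simple functions with a random measure -/

section Pairing

variable {d : ℕ} {ι : Type*} [Fintype ι] {Ω : Type*} {M : Set (Vec d) → Ω → EuclideanSpace ℝ ι}

/-- The sum `∑ w, ⟪M (F = w), L w⟫`, the integral of `L ∘ F` against `M`. -/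
noncomputable def pairing {W : Type*} (M : Set (Vec d) → Ω → EuclideanSpace ℝ ι)
    (L : W → EuclideanSpace ℝ ι) (F : SimpleFunc (Vec d) W) (ω : Ω) : ℝ :=
  ∑ w ∈ F.range, ⟪M (F ⁻¹' {w}) ω, L w⟫

/-- Values with zero coefficient must be discarded before using properties of `M`: their fibres may
have infinite volume, where `M` is unconstrained. -/
lemma pairing_filter {W : Type*} (F : SimpleFunc (Vec d) W) (L : W → EuclideanSpace ℝ ι)
    [DecidablePred fun w => L w ≠ 0] (ω : Ω) :
    pairing M L F ω = ∑ w ∈ F.range with L w ≠ 0, ⟪M (F ⁻¹' {w}) ω, L w⟫ := by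
  rw [pairing, Finset.sum_filter]
  refine Finset.sum_congr rfl fun w _ => ?_
  split_ifs with h
  · rfl
  · rw [not_not.1 h, inner_zero_right]

end Pairing

/-! ### Additivity and characteristic functions of the random measure -/

section RandomMeasure

variable {d : ℕ} {ι : Type*} [Fintype ι] {Ω : Type*} [MeasurableSpace Ω] {P : Measure Ω}
  {α : ℝ} {M : Set (Vec d) → Ω → EuclideanSpace ℝ ι}

instance : IsFiniteMeasure (uniformSphere ι α) := by
  rw [uniformSphere]
  exact Measure.smul_finite _ ENNReal.ofReal_ne_top

lemma mem_finiteSets {A : Set (Vec d)} (hA : MeasurableSet A) (hvol : volume A < ∞) :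
    A ∈ finiteSets (controlMeasure d ι α) := by
  refine ⟨hA, ?_⟩
  rw [controlMeasure, Measure.prod_prod]
  exact ENNReal.mul_lt_top hvol (measure_lt_top _ _)

/-- The normalization of the uniform measure turns the spectral integral into `‖θ‖ ^ α`: only the
length of `θ` matters. -/
lemma charFun_map_randomMeasure (hα : 0 < α)
    (hM : IsStableRandomMeasure α (controlMeasure d ι α) P M)
    {A : Set (Vec d)} (hA : MeasurableSet A) (hvol : volume A < ∞) (θ : EuclideanSpace ℝ ι) :
    charFun (P.map (M A)) θ = Complex.exp (-(((volume A).toReal * ‖θ‖ ^ α : ℝ) : ℂ)) := by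
  have h1 := hM.spectral A (mem_finiteSets hA hvol) θ
  have h2 : ((controlMeasure d ι α).restrict (A ×ˢ Set.univ)).snd =
      volume A • uniformSphere ι α := by
    rw [controlMeasure, ← Measure.prod_restrict, Measure.restrict_univ, Measure.snd,
      Measure.map_snd_prod, Measure.restrict_apply_univ]
  rw [h1, h2, integral_smul_measure, integral_uniformSphere hα, smul_eq_mul]

lemma randomMeasure_empty [IsProbabilityMeasure P] (hα : 0 < α)
    (hM : IsStableRandomMeasure α (controlMeasure d ι α) P M) : M ∅ =ᵐ[P] 0 := by
  have hmeas : Measurable (M ∅) := hM.measurable _ (mem_finiteSets .empty (by simp))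
  have : IsProbabilityMeasure (P.map (M ∅)) := Measure.isProbabilityMeasure_map hmeas.aemeasurable
  have h1 : P.map (M ∅) = Measure.dirac 0 := by
    refine Measure.ext_of_charFun (funext fun θ => ?_)
    rw [charFun_map_randomMeasure hα hM .empty (by simp), charFun_dirac]
    simp
  have h2 : ∀ᵐ x ∂(P.map (M ∅)), x = 0 := by
    rw [h1, ae_dirac_eq]
    exact eventually_pure.2 rfl
  exact ae_of_ae_map hmeas.aemeasurable h2

/-- Almost sure σ-additivity applied to `A, B, ∅, ∅, …`; the tail vanishes because `M ∅` has
characteristic function `1`. -/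
lemma randomMeasure_union [IsProbabilityMeasure P] (hα : 0 < α)
    (hM : IsStableRandomMeasure α (controlMeasure d ι α) P M)
    {A B : Set (Vec d)} (hA : MeasurableSet A) (hvA : volume A < ∞)
    (hB : MeasurableSet B) (hvB : volume B < ∞) (hAB : Disjoint A B) :
    M (A ∪ B) =ᵐ[P] M A + M B := by
  set C : ℕ → Set (Vec d) := fun n => if n = 0 then A else if n = 1 then B else ∅ with hC
  have hfin : ∀ j, C j ∈ finiteSets (controlMeasure d ι α) := fun j => by
    simp only [hC]
    split_ifs
    · exact mem_finiteSets hA hvA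
    · exact mem_finiteSets hB hvB
    · exact mem_finiteSets .empty (by simp)
  have hdisj : Pairwise fun i j => Disjoint (C i) (C j) := by
    intro i j hij
    simp only [hC]
    split_ifs <;> first | omega | simp [hAB.symm]
  have hU : ⋃ j, C j = A ∪ B := by
    ext x
    simp only [Set.mem_iUnion, Set.mem_union, hC]
    constructor
    · rintro ⟨j, hj⟩
      split_ifs at hj
      · exact Or.inl hj
      · exact Or.inr hj
      · exact hj.elim
    · rintro (h | h)
      · exact ⟨0, by simpa using h⟩
      · exact ⟨1, by simpa using h⟩
  have h1 := hM.sigma_additive C hfin hdisj (by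
    rw [hU]
    exact mem_finiteSets (hA.union hB) (measure_union_lt_top hvA hvB))
  rw [hU] at h1
  filter_upwards [h1, randomMeasure_empty hα hM] with ω h1 h2
  refine tendsto_nhds_unique h1 (tendsto_const_nhds.congr' ?_)
  filter_upwards [eventually_ge_atTop 2] with n hn
  obtain ⟨k, rfl⟩ := Nat.exists_eq_add_of_le' hn
  rw [Finset.sum_range_succ', Finset.sum_range_succ']
  have h3 : ∀ j ∈ Finset.range k, M (C (j + 1 + 1)) ω = 0 := fun j _ => by
    simpa [hC] using h2
  rw [Finset.sum_eq_zero h3]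
  simp [hC, add_comm]

lemma randomMeasure_biUnion [IsProbabilityMeasure P] (hα : 0 < α)
    (hM : IsStableRandomMeasure α (controlMeasure d ι α) P M) {W : Type*}
    (s : Finset W) (B : W → Set (Vec d)) (hB : ∀ w, MeasurableSet (B w))
    (hv : ∀ w ∈ s, volume (B w) < ∞) (hdisj : Pairwise fun v w => Disjoint (B v) (B w)) :
    M (⋃ w ∈ s, B w) =ᵐ[P] ∑ w ∈ s, M (B w) := by
  classical
  induction s using Finset.induction_on with
  | empty => simpa using randomMeasure_empty hα hM
  | insert a s ha ih =>
    have hv' : ∀ w ∈ s, volume (B w) < ∞ := fun w hw => hv w (Finset.mem_insert_of_mem hw)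
    rw [Finset.set_biUnion_insert, Finset.sum_insert ha]
    refine (randomMeasure_union hα hM (hB a) (hv a (Finset.mem_insert_self _ _))
      (s.measurableSet_biUnion fun w _ => hB w) ?_ ?_).trans ((ae_eq_refl _).add (ih hv'))
    · exact (measure_biUnion_lt_top s.finite_toSet hv')
    · rw [Set.disjoint_iUnion₂_right]
      exact fun w hw => hdisj fun h => ha (h ▸ hw)

/-- The integral of a simple function may be computed on any finer partition. This puts several
simple functions on one family of disjoint sets, where independence applies. -/
lemma pairing_map [IsProbabilityMeasure P] (hα : 0 < α)
    (hM : IsStableRandomMeasure α (controlMeasure d ι α) P M) {W W' : Type*}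
    (F : SimpleFunc (Vec d) W) (h : W → W') (L : W' → EuclideanSpace ℝ ι)
    (hF : ∀ w, L (h w) ≠ 0 → volume (F ⁻¹' {w}) < ∞) :
    pairing M L (F.map h) =ᵐ[P] pairing M (fun w => L (h w)) F := by
  classical
  have hadd : ∀ w' : W', ∀ᵐ ω ∂P, ⟪M (F.map h ⁻¹' {w'}) ω, L w'⟫ =
      ∑ w ∈ F.range with h w = w', ⟪M (F ⁻¹' {w}) ω, L (h w)⟫ := by
    intro w'
    by_cases hL : L w' = 0
    · refine Eventually.of_forall fun ω => ?_
      rw [hL, inner_zero_right]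
      refine (Finset.sum_eq_zero fun w hw => ?_).symm
      rw [(Finset.mem_filter.1 hw).2, hL, inner_zero_right]
    · have hset : F.map h ⁻¹' {w'} = ⋃ w ∈ F.range.filter (fun w => h w = w'), F ⁻¹' {w} := by
        ext x
        simp
      have h1 := randomMeasure_biUnion hα hM (F.range.filter fun w => h w = w')
        (fun w => F ⁻¹' {w}) (fun w => F.measurableSet_fiber w)
        (fun w hw => hF w (by rwa [(Finset.mem_filter.1 hw).2]))
        (fun v w hvw => Disjoint.preimage _ (by simpa using hvw))
      rw [hset]
      filter_upwards [h1] with ω hω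
      rw [hω, Finset.sum_apply, sum_inner]
      refine Finset.sum_congr rfl fun w hw => ?_
      rw [(Finset.mem_filter.1 hw).2]
  have hall : ∀ᵐ ω ∂P, ∀ w' ∈ (F.map h).range, ⟪M (F.map h ⁻¹' {w'}) ω, L w'⟫ =
      ∑ w ∈ F.range with h w = w', ⟪M (F ⁻¹' {w}) ω, L (h w)⟫ :=
    (ae_ball_iff (Finset.countable_toSet _)).2 fun w' _ => hadd w'
  filter_upwards [hall] with ω hω
  rw [pairing, pairing, Finset.sum_congr rfl hω]
  refine Finset.sum_fiberwise_of_maps_to (fun w hw => ?_) _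
  rw [SimpleFunc.range_map]
  exact Finset.mem_image_of_mem h hw

lemma measurable_pairing (hM : IsStableRandomMeasure α (controlMeasure d ι α) P M) {W : Type*}
    (F : SimpleFunc (Vec d) W) (L : W → EuclideanSpace ℝ ι)
    (hF : ∀ w, L w ≠ 0 → volume (F ⁻¹' {w}) < ∞) : Measurable (pairing M L F) := by
  classical
  have h : pairing M L F = fun ω => ∑ w ∈ F.range with L w ≠ 0, ⟪M (F ⁻¹' {w}) ω, L w⟫ :=
    funext fun ω => pairing_filter F L ω
  rw [h]
  refine Finset.measurable_sum _ fun w hw => ?_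
  exact (hM.measurable _ (mem_finiteSets (F.measurableSet_fiber w)
    (hF w (Finset.mem_filter.1 hw).2))).inner_const

/-- The fibres are disjoint, so the expectation factors; each factor is `exp (-λ(F = w) ‖L w‖ ^ α)`,
and the exponents add up to the integral of a simple function. -/
lemma integral_exp_pairing (hα : 0 < α)
    (hM : IsStableRandomMeasure α (controlMeasure d ι α) P M) {W : Type*}
    (F : SimpleFunc (Vec d) W) (L : W → EuclideanSpace ℝ ι)
    (hF : ∀ w, L w ≠ 0 → volume (F ⁻¹' {w}) < ∞) :
    ∫ ω, Complex.exp ((pairing M L F ω : ℂ) * Complex.I) ∂P =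
      Complex.exp (-(((∫⁻ u, ‖L (F u)‖ₑ ^ α).toReal : ℝ) : ℂ)) := by
  classical
  set s := F.range.filter fun w => L w ≠ 0 with hs
  have hsv : ∀ w ∈ s, volume (F ⁻¹' {w}) < ∞ := fun w hw => hF w (Finset.mem_filter.1 hw).2
  set e := s.equivFin
  set A : Fin s.card → Set (Vec d) := fun j => F ⁻¹' {(e.symm j : W)} with hA
  have hAv : ∀ j, volume (A j) < ∞ := fun j => hsv _ (e.symm j).2
  have hAm : ∀ j, MeasurableSet (A j) := fun j => F.measurableSet_fiber _
  have hAf : ∀ j, A j ∈ finiteSets (controlMeasure d ι α) := fun j => mem_finiteSets (hAm j) (hAv j)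
  have hMm : ∀ j, Measurable (M (A j)) := fun j => hM.measurable _ (hAf j)
  have hind : iIndepFun (fun j => M (A j)) P := hM.independently_scattered _ A hAf fun i j hij =>
    Disjoint.preimage _ (by simpa [Subtype.ext_iff] using fun h => hij (e.symm.injective (Subtype.ext h)))
  have hsum : ∀ ω, pairing M L F ω = ∑ j, ⟪M (A j) ω, L (e.symm j)⟫ := fun ω => by
    rw [pairing_filter, ← hs, ← Finset.sum_coe_sort s,
      ← e.symm.sum_comp (fun w : s => ⟪M (F ⁻¹' {(w : W)}) ω, L w⟫)]
  have hprod : ∀ ω, Complex.exp ((pairing M L F ω : ℂ) * Complex.I) =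
      ∏ j, Complex.exp ((⟪M (A j) ω, L (e.symm j)⟫ : ℝ) * Complex.I) := fun ω => by
    rw [hsum, Complex.ofReal_sum, Finset.sum_mul, Complex.exp_sum]
  simp_rw [hprod]
  rw [hind.integral_fun_prod_comp (f := fun j x => Complex.exp ((⟪x, L (e.symm j)⟫ : ℝ) * Complex.I))
    (fun j => (hMm j).aemeasurable) (fun j => by
      refine Continuous.aestronglyMeasurable ?_
      fun_prop)]
  have hchar : ∀ j, ∫ ω, Complex.exp ((⟪M (A j) ω, L (e.symm j)⟫ : ℝ) * Complex.I) ∂P =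
      Complex.exp (-(((volume (A j)).toReal * ‖L (e.symm j)‖ ^ α : ℝ) : ℂ)) := fun j => by
    rw [← charFun_map_randomMeasure hα hM (hAm j) (hAv j), charFun_apply, integral_map
      (hMm j).aemeasurable]
    refine Continuous.aestronglyMeasurable ?_
    fun_prop
  simp_rw [hchar]
  rw [← Complex.exp_sum, Finset.sum_neg_distrib, ← Complex.ofReal_sum]
  congr 3
  have h1 : ∫⁻ u, ‖L (F u)‖ₑ ^ α = ∑ w ∈ s, ‖L w‖ₑ ^ α * volume (F ⁻¹' {w}) := by
    have h2 : ∫⁻ u, ‖L (F u)‖ₑ ^ α = ∫⁻ u, F.map (fun w => ‖L w‖ₑ ^ α) u := rfl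
    rw [h2, SimpleFunc.lintegral_eq_lintegral, SimpleFunc.map_lintegral, hs, Finset.sum_filter]
    refine Finset.sum_congr rfl fun w _ => ?_
    split_ifs with h
    · rfl
    · rw [not_not.1 h, enorm_zero, ENNReal.zero_rpow_of_pos hα, zero_mul]
  rw [h1, ENNReal.toReal_sum, ← Finset.sum_coe_sort s, ← e.symm.sum_comp]
  · refine Finset.sum_congr rfl fun j _ => ?_
    rw [ENNReal.toReal_mul, ← ENNReal.toReal_rpow, toReal_enorm, mul_comm]
  · intro w hw
    exact ENNReal.mul_ne_top (ENNReal.rpow_ne_top_of_nonneg hα.le enorm_ne_top) (hsv w hw).ne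

end RandomMeasure

/-! ### Tail bound from a stable characteristic function -/

section TailBound

variable {Ω : Type*} [MeasurableSpace Ω] {P : Measure Ω} [IsProbabilityMeasure P]

/-- The truncation inequality bounds the tail by `(r/2) ∫ (1 - φ)` over `|t| ≤ 2/r`. There `1 - φ(t)
≤ |t| ^ α c ≤ (2/r) ^ α c`, and the interval has length `4/r`. -/
lemma measureReal_abs_gt_le_of_charFun {α c : ℝ} (hα : 0 < α) (hc : 0 ≤ c) {Z : Ω → ℝ}
    (hZ : Measurable Z)
    (h : ∀ t : ℝ, ∫ ω, Complex.exp (((t * Z ω : ℝ) : ℂ) * Complex.I) ∂P =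
      Complex.exp (-((|t| ^ α * c : ℝ) : ℂ))) {r : ℝ} (hr : 0 < r) :
    P.real {ω | r < |Z ω|} ≤ 2 * (2 / r) ^ α * c := by
  have : IsProbabilityMeasure (P.map Z) := Measure.isProbabilityMeasure_map hZ.aemeasurable
  have h1 := measureReal_abs_gt_le_integral_charFun (μ := P.map Z) hr
  have h2 : (P.map Z).real {x | r < |x|} = P.real {ω | r < |Z ω|} := by
    rw [map_measureReal_apply hZ (s := {x : ℝ | r < |x|})
      (measurableSet_lt measurable_const (by fun_prop))]
    rfl
  have h3 : ∀ t ∈ Set.uIoc (-2 * r⁻¹) (2 * r⁻¹), ‖1 - charFun (P.map Z) t‖ ≤ (2 / r) ^ α * c := by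
    intro t ht
    have hneg : -2 * r⁻¹ ≤ 2 * r⁻¹ := by
      have := inv_pos.2 hr
      linarith
    rw [Set.uIoc_of_le hneg] at ht
    have htr : |t| ≤ 2 / r := by
      rw [abs_le, div_eq_mul_inv]
      exact ⟨by linarith [ht.1], ht.2⟩
    have hcf : charFun (P.map Z) t = Complex.exp (-((|t| ^ α * c : ℝ) : ℂ)) := by
      rw [← h t, charFun_apply_real, integral_map hZ.aemeasurable (by
        refine Continuous.aestronglyMeasurable ?_
        fun_prop)]
      simp
    have hx : 0 ≤ |t| ^ α * c := by positivity
    rw [hcf, ← Complex.ofReal_neg, ← Complex.ofReal_exp, ← Complex.ofReal_one,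
      ← Complex.ofReal_sub, Complex.norm_real, Real.norm_of_nonneg
        (by linarith [Real.exp_le_one_iff.2 (neg_nonpos.2 hx)])]
    calc 1 - Real.exp (-(|t| ^ α * c)) ≤ |t| ^ α * c := by
          linarith [Real.add_one_le_exp (-(|t| ^ α * c))]
      _ ≤ _ := by gcongr
  have h4 := intervalIntegral.norm_integral_le_of_norm_le_const h3
  rw [h2] at h1
  have h5 : |2 * r⁻¹ - -2 * r⁻¹| = 4 * r⁻¹ := by
    rw [abs_of_pos (by have := inv_pos.2 hr; linarith)]
    ring
  rw [h5] at h4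
  calc P.real {ω | r < |Z ω|} ≤ 2⁻¹ * r * ((2 / r) ^ α * c * (4 * r⁻¹)) := by
        refine h1.trans ?_
        gcongr
    _ = _ := by field_simp; ring

end TailBound

/-! ### Completeness of convergence in probability -/

section CauchyInMeasure

variable {Ω : Type*} [MeasurableSpace Ω] {P : Measure Ω} {E : Type*}
  [NormedAddCommGroup E]

lemma measure_le_norm_add_le (Y Z : Ω → E) (ε : ℝ) :
    P {ω | ε ≤ ‖Y ω + Z ω‖} ≤ P {ω | ε / 2 ≤ ‖Y ω‖} + P {ω | ε / 2 ≤ ‖Z ω‖} := by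
  refine (measure_mono fun ω hω => ?_).trans (measure_union_le _ _)
  by_contra h
  simp only [Set.mem_union, Set.mem_ofPred_eq, not_or, not_le] at h hω
  linarith [norm_add_le (Y ω) (Z ω)]

lemma measure_le_norm_sub_le (X Y Z : Ω → E) (ε : ℝ) :
    P {ω | ε ≤ ‖X ω - Z ω‖} ≤ P {ω | ε / 2 ≤ ‖X ω - Y ω‖} + P {ω | ε / 2 ≤ ‖Y ω - Z ω‖} := by
  simpa using measure_le_norm_add_le (P := P) (fun ω => X ω - Y ω) (fun ω => Y ω - Z ω) ε

/-- Sequences that are Cauchy in probability converge in probability. -/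
lemma exists_tendstoInMeasure_of_cauchy [IsProbabilityMeasure P] [CompleteSpace E]
    [MeasurableSpace E] [BorelSpace E] [SecondCountableTopology E] {Y : ℕ → Ω → E}
    (hY : ∀ n, Measurable (Y n)) {b : ℕ → ℝ≥0∞} (hb : Tendsto b atTop (𝓝 0))
    (h : ∀ ε : ℝ, 0 < ε → ∃ C : ℝ≥0∞, C ≠ ∞ ∧ ∀ n p,
      P {ω | ε ≤ ‖Y n ω - Y p ω‖} ≤ C * (b n + b p)) :
    ∃ X : Ω → E, Measurable X ∧ TendstoInMeasure P Y atTop X := by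
  -- Geometric tolerances, so that Borel–Cantelli makes the extracted subsequence almost surely
  -- Cauchy.
  have hev : ∀ k : ℕ, ∀ᶠ n in atTop, ∀ q ≥ n,
      P {ω | (1 / 2 : ℝ) ^ k ≤ ‖Y q ω - Y n ω‖} ≤ (1 / 2 : ℝ≥0∞) ^ k := by
    intro k
    obtain ⟨C, hC, hCb⟩ := h ((1 / 2 : ℝ) ^ k) (by positivity)
    have hlim : Tendsto (fun n => C * (b n + b n)) atTop (𝓝 0) := by
      simpa using ENNReal.Tendsto.const_mul (hb.add hb) (Or.inr hC)
    have hlim2 : Tendsto (fun n => C * b n) atTop (𝓝 0) := by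
      simpa using ENNReal.Tendsto.const_mul hb (Or.inr hC)
    have hpos : (0 : ℝ≥0∞) < (1 / 2 : ℝ≥0∞) ^ k / 2 := by
      refine ENNReal.div_pos (pow_ne_zero _ ?_) (by norm_num)
      simp
    obtain ⟨N, hN⟩ := eventually_atTop.1 (hlim2.eventually_le_const hpos)
    filter_upwards [eventually_ge_atTop N] with n hn q hq
    refine (hCb q n).trans ?_
    rw [mul_add]
    exact (add_le_add (hN q (hn.trans hq)) (hN n hn)).trans (ENNReal.add_halves _).le
  obtain ⟨φ, hφ, hφP⟩ := extraction_forall_of_eventually hev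
  have hsum : ∑' k, P {ω | (1 / 2 : ℝ) ^ k ≤ ‖Y (φ (k + 1)) ω - Y (φ k) ω‖} ≠ ∞ := by
    refine ne_top_of_le_ne_top ?_
      (ENNReal.tsum_le_tsum fun k => hφP k (φ (k + 1)) (hφ (Nat.lt_succ_self k)).le)
    rw [ENNReal.tsum_geometric]
    simp
  have hae : ∀ᵐ ω ∂P, ∃ l, Tendsto (fun k => Y (φ k) ω) atTop (𝓝 l) := by
    filter_upwards [ae_eventually_notMem hsum] with ω hω
    refine cauchySeq_tendsto_of_complete (cauchySeq_of_summable_dist ?_)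
    refine Summable.of_norm_bounded_eventually_nat (g := fun k => (1 / 2 : ℝ) ^ k)
      (summable_geometric_of_lt_one (by norm_num) (by norm_num)) ?_
    filter_upwards [hω] with k hk
    simp only [not_le] at hk
    rw [Real.norm_of_nonneg dist_nonneg, dist_comm, dist_eq_norm]
    exact hk.le
  obtain ⟨X, hX, hXlim⟩ := measurable_limit_of_tendsto_metrizable_ae
    (fun k => (hY (φ k)).aemeasurable) hae
  refine ⟨X, hX, ?_⟩
  have hsub : TendstoInMeasure P (fun k => Y (φ k)) atTop X :=
    tendstoInMeasure_of_tendsto_ae (fun k => (hY _).aestronglyMeasurable) hXlim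
  rw [tendstoInMeasure_iff_norm] at hsub ⊢
  intro ε hε
  obtain ⟨C, hC, hCb⟩ := h (ε / 2) (by positivity)
  -- Comparing with `Y (φ k)` and letting `k → ∞` bounds the distance to the limit for every `n`, so
  -- the whole sequence converges.
  have hle : ∀ n, P {ω | ε ≤ ‖Y n ω - X ω‖} ≤ C * b n := by
    intro n
    have hlim : Tendsto (fun k => C * (b n + b (φ k)) +
        P {ω | ε / 2 ≤ ‖Y (φ k) ω - X ω‖}) atTop (𝓝 (C * (b n + 0) + 0)) :=
      (ENNReal.Tendsto.const_mul (tendsto_const_nhds.add (hb.comp hφ.tendsto_atTop))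
        (Or.inr hC)).add (hsub (ε / 2) (by positivity))
    rw [add_zero, add_zero] at hlim
    refine ge_of_tendsto' hlim fun k => ?_
    exact (measure_le_norm_sub_le (Y n) (Y (φ k)) X ε).trans (add_le_add (hCb _ _) le_rfl)
  refine tendsto_of_tendsto_of_tendsto_of_le_of_le tendsto_const_nhds ?_ (fun _ => zero_le) hle
  simpa using ENNReal.Tendsto.const_mul hb (Or.inr hC)

end CauchyInMeasure

/-- Replacing every term by the largest one works for `α < 1` and `α ≥ 1` alike. -/
lemma ennreal_rpow_sum_le {k : ℕ} {α : ℝ} (hα : 0 ≤ α) (a : Fin k → ℝ≥0∞) (hk : k ≠ 0):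
    (∑ j, a j) ^ α ≤ (k : ℝ≥0∞) ^ α * ∑ j, a j ^ α := by
  have : Nonempty (Fin k) := ⟨⟨0, Nat.pos_of_ne_zero hk⟩⟩
  obtain ⟨j₀, -, hj₀⟩ := Finset.exists_max_image Finset.univ a Finset.univ_nonempty
  calc (∑ j, a j) ^ α ≤ (k * a j₀) ^ α := by
        gcongr
        refine (Finset.sum_le_card_nsmul _ _ _ fun j hj => hj₀ j hj).trans ?_
        simp
    _ = (k : ℝ≥0∞) ^ α * a j₀ ^ α := ENNReal.mul_rpow_of_nonneg _ _ hα
    _ ≤ _ := by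
        gcongr
        exact Finset.single_le_sum (f := fun j => a j ^ α) (fun _ _ => zero_le) (Finset.mem_univ j₀)

lemma ennreal_rpow_add_le {α : ℝ} (hα : 0 ≤ α) (a b : ℝ≥0∞) :
    (a + b) ^ α ≤ (2 : ℝ≥0∞) ^ α * (a ^ α + b ^ α) := by
  simpa using ennreal_rpow_sum_le hα ![a, b] two_ne_zero

/-! ### Coefficient vectors and matrix norms -/

section Coefficients

variable {d m : ℕ} {Ω : Type*}

/-- The vector with `⟪M, coef θ C⟫ = ⟪θ, Re (C M̃)⟫`. -/
noncomputable def coef (θ : Vec m) (C : Matrix (Fin m) (Fin m) ℂ) :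
    EuclideanSpace ℝ (Fin m ⊕ Fin m) :=
  WithLp.toLp 2 (Sum.elim (fun k => ∑ i, θ i * (C i k).re) (fun k => -∑ i, θ i * (C i k).im))

lemma inner_reSimpleIntegral (M : Set (Vec d) → Ω → EuclideanSpace ℝ (Fin m ⊕ Fin m))
    (f : SimpleFunc (Vec d) (Matrix (Fin m) (Fin m) ℂ)) (θ : Vec m) (ω : Ω) :
    ⟪θ, reSimpleIntegral M f ω⟫ = pairing M (coef θ) f ω := by
  have h : ∀ C : Matrix (Fin m) (Fin m) ℂ, ⟪M (f ⁻¹' {C}) ω, coef θ C⟫ =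
      ∑ i, θ i * ((C *ᵥ complexMeasure M (f ⁻¹' {C}) ω) i).re := by
    intro C
    simp only [coef, PiLp.inner_apply, Fintype.sum_sum_type, Sum.elim_inl, Sum.elim_inr,
      Matrix.mulVec, dotProduct, complexMeasure, Complex.re_sum, RCLike.inner_apply, conj_trivial]
    rw [← Finset.sum_add_distrib]
    simp_rw [Finset.mul_sum, neg_mul, Finset.sum_mul]
    rw [Finset.sum_comm]
    simp_rw [← Finset.sum_neg_distrib, ← Finset.sum_add_distrib]
    refine Finset.sum_congr rfl fun i _ => Finset.sum_congr rfl fun k _ => ?_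
    simp
    ring
  simp only [reSimpleIntegral, pairing, h, PiLp.inner_apply, RCLike.inner_apply, conj_trivial,
    Finset.sum_apply, Complex.re_sum]
  rw [Finset.sum_comm]
  refine Finset.sum_congr rfl fun i _ => ?_
  rw [mul_comm, Finset.mul_sum]

lemma coef_zero_right (θ : Vec m) : coef θ 0 = 0 := by
  ext k
  rcases k with k | k <;> simp [coef]

lemma coef_sub_right (θ : Vec m) (C C' : Matrix (Fin m) (Fin m) ℂ) :
    coef θ (C - C') = coef θ C - coef θ C' := by
  ext k
  rcases k with k | k <;> simp [coef, mul_sub, Finset.sum_sub_distrib]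
  ring

lemma coef_smul_left (c : ℝ) (θ : Vec m) (C : Matrix (Fin m) (Fin m) ℂ) :
    coef (c • θ) C = c • coef θ C := by
  ext k
  rcases k with k | k <;> simp [coef, Finset.mul_sum, mul_assoc]

lemma coef_neg_left (θ : Vec m) (C : Matrix (Fin m) (Fin m) ℂ) : coef (-θ) C = -coef θ C := by
  simpa using coef_smul_left (-1) θ C

/-- The sum of the operator norms of the real and the imaginary part. -/
noncomputable def opSize (C : Matrix (Fin m) (Fin m) ℂ) : ℝ :=
  ‖op (C.map Complex.re)‖ + ‖op (C.map Complex.im)‖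

lemma opSize_nonneg (C : Matrix (Fin m) (Fin m) ℂ) : 0 ≤ opSize C := by
  unfold opSize; positivity

lemma norm_coef_le (θ : Vec m) (C : Matrix (Fin m) (Fin m) ℂ) :
    ‖coef θ C‖ ≤ ‖θ‖ * opSize C := by
  have happ : ∀ (A : Matrix (Fin m) (Fin m) ℝ) (k : Fin m), (op Aᵀ θ) k = ∑ i, θ i * A i k := by
    intro A k
    have h : (op Aᵀ θ) k = (Aᵀ *ᵥ (WithLp.ofLp θ)) k := rfl
    rw [h]
    simp [Matrix.mulVec, dotProduct, mul_comm]
  have hsq : ‖coef θ C‖ ^ 2 = ‖op (C.map Complex.re)ᵀ θ‖ ^ 2 + ‖op (C.map Complex.im)ᵀ θ‖ ^ 2 := by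
    rw [EuclideanSpace.norm_sq_eq, EuclideanSpace.norm_sq_eq, EuclideanSpace.norm_sq_eq,
      Fintype.sum_sum_type]
    simp [coef, happ]
  have h1 : ∀ A : Matrix (Fin m) (Fin m) ℝ, ‖op Aᵀ θ‖ ≤ ‖op A‖ * ‖θ‖ := fun A => by
    rw [← norm_op_transpose]; exact ContinuousLinearMap.le_opNorm _ _
  have h2 := h1 (C.map Complex.re)
  have h3 := h1 (C.map Complex.im)
  refine le_of_sq_le_sq ?_ (mul_nonneg (norm_nonneg _) (opSize_nonneg C))
  rw [hsq, opSize]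
  have h4 := norm_nonneg (op (C.map Complex.re)ᵀ θ)
  have h5 := norm_nonneg (op (C.map Complex.im)ᵀ θ)
  nlinarith [mul_nonneg h4 h5]

/-- Read in `ℂ^m`, `coef θ C` is the complex conjugate of the row vector `θᵀ C`. -/
lemma norm_sum_coef_sq {k : ℕ} (θ : Fin k → Vec m) (C : Fin k → Matrix (Fin m) (Fin m) ℂ) :
    ‖∑ j, coef (θ j) (C j)‖ ^ 2 = ∑ l, ‖∑ j, ∑ i, (θ j i : ℂ) * C j i l‖ ^ 2 := by
  rw [EuclideanSpace.norm_sq_eq, Fintype.sum_sum_type, ← Finset.sum_add_distrib]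
  refine Finset.sum_congr rfl fun l _ => ?_
  rw [Complex.sq_norm, Complex.normSq_apply]
  simp [coef, Complex.re_sum, Complex.im_sum, sq]

/-- In `ℂ^m` the factor `c` becomes a scalar multiplication. For a phase `|c| = 1` the norm is
unchanged, which is the source of stationary increments. -/
lemma norm_sum_coef_smul {k : ℕ} (θ : Fin k → Vec m) (C : Fin k → Matrix (Fin m) (Fin m) ℂ)
    (c : ℂ) : ‖∑ j, coef (θ j) (c • C j)‖ = ‖c‖ * ‖∑ j, coef (θ j) (C j)‖ := by
  refine (sq_eq_sq₀ (norm_nonneg _) (by positivity)).1 ?_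
  rw [mul_pow, norm_sum_coef_sq, norm_sum_coef_sq, Finset.mul_sum]
  refine Finset.sum_congr rfl fun l _ => ?_
  rw [← mul_pow, ← norm_mul]
  simp only [Finset.mul_sum, Matrix.smul_apply, smul_eq_mul, mul_left_comm]

lemma continuous_coef (θ : Vec m) : Continuous (coef θ) := by
  unfold coef
  refine (PiLp.continuous_toLp 2 _).comp (continuous_pi fun k => ?_)
  have h : ∀ i j, Continuous fun C : Matrix (Fin m) (Fin m) ℂ => C i j := fun i j =>
    continuous_id.matrix_elem i j
  rcases k with k | k
  · simp only [Sum.elim_inl]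
    fun_prop
  · simp only [Sum.elim_inr]
    fun_prop

lemma continuous_op : Continuous (op (n := m)) :=
  LinearMap.continuous_of_finiteDimensional
    (Matrix.toEuclideanCLM (n := Fin m) (𝕜 := ℝ)).toAlgEquiv.toLinearMap

/-- With `norm_le_opSize`, this compares `opSize` with the sup norm on `Fin m → Fin m → ℂ`, the norm
in which the approximation by simple functions is carried out. -/
lemma exists_opSize_le : ∃ K : ℝ, 0 ≤ K ∧ ∀ C : Fin m → Fin m → ℂ, opSize (m := m) C ≤ K * ‖C‖ := by
  let re : (Fin m → Fin m → ℂ) →ₗ[ℝ] (Vec m →L[ℝ] Vec m) :=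
    (Matrix.toEuclideanCLM (n := Fin m) (𝕜 := ℝ)).toAlgEquiv.toLinearMap.comp
      (Complex.reLm.mapMatrix (m := Fin m) (n := Fin m))
  let im : (Fin m → Fin m → ℂ) →ₗ[ℝ] (Vec m →L[ℝ] Vec m) :=
    (Matrix.toEuclideanCLM (n := Fin m) (𝕜 := ℝ)).toAlgEquiv.toLinearMap.comp
      (Complex.imLm.mapMatrix (m := Fin m) (n := Fin m))
  obtain ⟨K, hK, h⟩ := exists_norm_map_le re
  obtain ⟨K', hK', h'⟩ := exists_norm_map_le im
  refine ⟨K + K', by positivity, fun C => ?_⟩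
  rw [add_mul]
  exact add_le_add (h C) (h' C)

lemma abs_apply_le_norm_op (A : Matrix (Fin m) (Fin m) ℝ) (i j : Fin m) : |A i j| ≤ ‖op A‖ := by
  have h : A i j = op A (EuclideanSpace.single j 1) i := by
    have h1 : op A (EuclideanSpace.single j 1) i = (A *ᵥ Pi.single j 1) i := rfl
    rw [h1]; simp
  rw [h, ← Real.norm_eq_abs]
  refine (PiLp.norm_apply_le _ i).trans ((ContinuousLinearMap.le_opNorm _ _).trans ?_)
  simp

lemma norm_le_opSize (C : Fin m → Fin m → ℂ) : ‖C‖ ≤ opSize (m := m) C := by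
  refine (pi_norm_le_iff_of_nonneg (opSize_nonneg _)).2 fun i =>
    (pi_norm_le_iff_of_nonneg (opSize_nonneg _)).2 fun j => ?_
  refine (Complex.norm_le_abs_re_add_abs_im _).trans ?_
  exact add_le_add (abs_apply_le_norm_op (Matrix.map C Complex.re) i j)
    (abs_apply_le_norm_op (Matrix.map C Complex.im) i j)

end Coefficients

/-! ### Approximation by simple functions in the `α`-th mean -/

section AlphaSize

variable {d m : ℕ} {α : ℝ}

lemma ofReal_opSize_rpow_le (hα : 0 ≤ α) (C : Matrix (Fin m) (Fin m) ℂ) :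
    ENNReal.ofReal (opSize C) ^ α ≤
      2 ^ α * (‖op (C.map Complex.re)‖ₑ ^ α + ‖op (C.map Complex.im)‖ₑ ^ α) := by
  rw [opSize, ENNReal.ofReal_add (norm_nonneg _) (norm_nonneg _), ofReal_norm, ofReal_norm]
  exact ennreal_rpow_add_le hα _ _

lemma lintegral_opSize_le (hα : 0 ≤ α) (Q : Vec d → Matrix (Fin m) (Fin m) ℂ) :
    ∫⁻ u, ENNReal.ofReal (opSize (Q u)) ^ α ≤ 2 ^ α * alphaSize α Q := by
  rw [alphaSize, ← lintegral_const_mul' _ _ (by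
    exact ENNReal.rpow_ne_top_of_nonneg hα (by norm_num))]
  exact lintegral_mono fun u => ofReal_opSize_rpow_le hα (Q u)

lemma enorm_op_le_opSize (C : Matrix (Fin m) (Fin m) ℂ) :
    ‖op (C.map Complex.re)‖ₑ ≤ ENNReal.ofReal (opSize C) ∧
      ‖op (C.map Complex.im)‖ₑ ≤ ENNReal.ofReal (opSize C) := by
  rw [← ofReal_norm, ← ofReal_norm, opSize]
  exact ⟨ENNReal.ofReal_le_ofReal (by linarith [norm_nonneg (op (C.map Complex.im))]),
    ENNReal.ofReal_le_ofReal (by linarith [norm_nonneg (op (C.map Complex.re))])⟩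

lemma alphaSize_le (hα : 0 ≤ α) (Q : Vec d → Matrix (Fin m) (Fin m) ℂ) :
    alphaSize α Q ≤ 2 * ∫⁻ u, ENNReal.ofReal (opSize (Q u)) ^ α := by
  rw [alphaSize, ← lintegral_const_mul' _ _ (by norm_num)]
  refine lintegral_mono fun u => ?_
  simp only [two_mul]
  exact add_le_add (ENNReal.rpow_le_rpow (enorm_op_le_opSize _).1 hα)
    (ENNReal.rpow_le_rpow (enorm_op_le_opSize _).2 hα)

lemma opSize_sub_le (C C' : Matrix (Fin m) (Fin m) ℂ) : opSize (C - C') ≤ opSize C + opSize C' := by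
  have hre : op ((C - C').map Complex.re) = op (C.map Complex.re) - op (C'.map Complex.re) := by
    exact map_sub (Matrix.toEuclideanCLM (n := Fin m) (𝕜 := ℝ)) _ _
  have him : op ((C - C').map Complex.im) = op (C.map Complex.im) - op (C'.map Complex.im) := by
    exact map_sub (Matrix.toEuclideanCLM (n := Fin m) (𝕜 := ℝ)) _ _
  rw [opSize, hre, him, opSize, opSize]
  linarith [norm_sub_le (op (C.map Complex.re)) (op (C'.map Complex.re)),
    norm_sub_le (op (C.map Complex.im)) (op (C'.map Complex.im))]

lemma continuous_opSize : Continuous (opSize (m := m)) := by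
  unfold opSize
  have h1 : Continuous fun C : Matrix (Fin m) (Fin m) ℂ => C.map Complex.re :=
    continuous_id.matrix_map Complex.continuous_re
  have h2 : Continuous fun C : Matrix (Fin m) (Fin m) ℂ => C.map Complex.im :=
    continuous_id.matrix_map Complex.continuous_im
  exact (continuous_op.comp h1).norm.add (continuous_op.comp h2).norm

lemma measurable_comp_of_continuous {X : Type*} [TopologicalSpace X] [MeasurableSpace X]
    [BorelSpace X] {g : Matrix (Fin m) (Fin m) ℂ → X} (hg : Continuous g)
    {Q : Vec d → Matrix (Fin m) (Fin m) ℂ} (hQ : ∀ i j, Measurable fun u => Q u i j) :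
    Measurable fun u => g (Q u) := by
  have hQ' : Measurable (β := Fin m → Fin m → ℂ) Q :=
    measurable_pi_lambda _ fun i => measurable_pi_lambda _ fun j => hQ i j
  have hg' : Continuous (X := Fin m → Fin m → ℂ) g := hg
  exact hg'.measurable.comp hQ'

/-- The standard approximants stay within `‖Q‖` of `Q`, so dominated convergence applies. Their
pointwise domination by `Q` is kept as a conclusion because it is needed again when passing to the
limit in characteristic functions. -/
lemma exists_simpleFunc_approx_pi (hα : 0 < α) {Q : Vec d → Fin m → Fin m → ℂ}
    (hQ : Measurable Q) (hfin : ∫⁻ u, ENNReal.ofReal (opSize (m := m) (Q u)) ^ α < ∞) :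
    ∃ f : ℕ → SimpleFunc (Vec d) (Fin m → Fin m → ℂ),
      (∀ n C, C ≠ 0 → volume (f n ⁻¹' {C}) < ∞) ∧
      Tendsto (fun n => ∫⁻ u, ENNReal.ofReal (opSize (m := m) (Q u - f n u)) ^ α) atTop (𝓝 0) ∧
      (∀ u, Tendsto (fun n => f n u) atTop (𝓝 (Q u))) ∧
      ∃ K : ℝ, 0 ≤ K ∧ ∀ n u, opSize (m := m) (f n u) ≤ K * opSize (m := m) (Q u) := by
  obtain ⟨K, hK, hKb⟩ := exists_opSize_le (m := m)
  have hcont : Continuous fun C : Fin m → Fin m → ℂ => opSize (m := m) C := continuous_opSize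
  let f : ℕ → SimpleFunc (Vec d) (Fin m → Fin m → ℂ) := fun n =>
    SimpleFunc.approxOn Q hQ Set.univ 0 (Set.mem_univ _) n
  have hlim : ∀ u, Tendsto (fun n => f n u) atTop (𝓝 (Q u)) := fun u =>
    SimpleFunc.tendsto_approxOn hQ (Set.mem_univ _) (by simp)
  have hbd : ∀ n u, opSize (m := m) (f n u) ≤ (2 * K) * opSize (m := m) (Q u) := fun n u => by
    have h1 : ‖f n u‖ ≤ ‖Q u‖ + ‖Q u‖ :=
      SimpleFunc.norm_approxOn_zero_le hQ (Set.mem_univ _) u n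
    nlinarith [hKb (f n u), norm_le_opSize (Q u)]
  have hmeas : ∀ n, Measurable fun u => ENNReal.ofReal (opSize (m := m) (f n u)) ^ α := fun n =>
    (hcont.measurable.comp (f n).measurable).ennreal_ofReal.pow_const α
  refine ⟨f, fun n C hC => ?_, ?_, hlim, 2 * K, by positivity, hbd⟩
  · have hC' : 0 < ENNReal.ofReal (opSize (m := m) C) :=
      ENNReal.ofReal_pos.2 ((norm_pos_iff.2 hC).trans_le (norm_le_opSize C))
    have hCα : ENNReal.ofReal (opSize (m := m) C) ^ α ≠ 0 :=
      (ENNReal.rpow_pos hC' ENNReal.ofReal_ne_top).ne'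
    have h1 : ∫⁻ u, ENNReal.ofReal (opSize (m := m) (f n u)) ^ α < ∞ := by
      refine lt_of_le_of_lt (b := ∫⁻ u, ENNReal.ofReal (2 * K) ^ α *
        ENNReal.ofReal (opSize (m := m) (Q u)) ^ α) ?_ ?_
      · refine lintegral_mono fun u => ?_
        rw [← ENNReal.mul_rpow_of_nonneg _ _ hα.le, ← ENNReal.ofReal_mul (by positivity)]
        gcongr
        exact hbd n u
      · rw [lintegral_const_mul' _ _ (by finiteness)]
        exact ENNReal.mul_lt_top (by finiteness) hfin
    -- Markov's inequality at the level attained on the fibre of `C`.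
    have h2 := meas_ge_le_lintegral_div (μ := (volume : Measure (Vec d))) (hmeas n).aemeasurable
      hCα (by finiteness)
    refine (measure_mono fun u hu => ?_).trans_lt (h2.trans_lt (ENNReal.div_lt_top h1.ne hCα))
    have hu' : f n u = C := hu
    simp only [Set.mem_ofPred_eq, hu', le_refl]
  · rw [← lintegral_zero (μ := (volume : Measure (Vec d)))]
    refine tendsto_lintegral_of_dominated_convergence
      (fun u => ENNReal.ofReal K ^ α * ENNReal.ofReal (opSize (m := m) (Q u)) ^ α) (fun n => ?_)
      (fun n => Eventually.of_forall fun u => ?_) ?_ (Eventually.of_forall fun u => ?_)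
    · exact (hcont.measurable.comp (hQ.sub (f n).measurable)).ennreal_ofReal.pow_const α
    · have h1 : ‖f n u - Q u‖₊ ≤ ‖Q u - 0‖₊ :=
        SimpleFunc.nnnorm_approxOn_le hQ (Set.mem_univ _) u n
      rw [sub_zero] at h1
      have h2 : ‖f n u - Q u‖ ≤ ‖Q u‖ := h1
      rw [norm_sub_rev] at h2
      change ENNReal.ofReal (opSize (m := m) (Q u - f n u)) ^ α ≤
        ENNReal.ofReal K ^ α * ENNReal.ofReal (opSize (m := m) (Q u)) ^ α
      rw [← ENNReal.mul_rpow_of_nonneg _ _ hα.le, ← ENNReal.ofReal_mul (by positivity)]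
      gcongr
      exact (hKb _).trans (mul_le_mul_of_nonneg_left (h2.trans (norm_le_opSize _)) hK)
    · rw [lintegral_const_mul' _ _ (by finiteness)]
      exact (ENNReal.mul_lt_top (by finiteness) hfin).ne
    · have h1 : Tendsto (fun n => Q u - f n u) atTop (𝓝 (Q u - Q u)) :=
        tendsto_const_nhds.sub (hlim u)
      have h3 : Tendsto (fun n => ENNReal.ofReal (opSize (m := m) (Q u - f n u)) ^ α) atTop
          (𝓝 (ENNReal.ofReal (opSize (m := m) (Q u - Q u)) ^ α)) :=
        ((ENNReal.continuous_rpow_const (y := α)).tendsto _).comp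
          (ENNReal.tendsto_ofReal ((hcont.tendsto _).comp h1))
      have h4 : opSize (m := m) (Q u - Q u) = 0 := by
        rw [sub_self]
        refine le_antisymm ?_ (opSize_nonneg _)
        simpa using hKb 0
      rwa [h4, ENNReal.ofReal_zero, ENNReal.zero_rpow_of_pos hα] at h3

lemma exists_simpleFunc_approx (hα : 0 < α) {Q : Vec d → Matrix (Fin m) (Fin m) ℂ}
    (hQ : IsIntegrand α Q) :
    ∃ f : ℕ → SimpleFunc (Vec d) (Matrix (Fin m) (Fin m) ℂ),
      (∀ n, (f n).FinMeasSupp volume) ∧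
      Tendsto (fun n => alphaSize α fun u => Q u - f n u) atTop (𝓝 0) ∧
      (∀ u, Tendsto (fun n => f n u) atTop (𝓝 (Q u))) ∧
      ∃ K : ℝ, 0 ≤ K ∧ ∀ n u, opSize (f n u) ≤ K * opSize (Q u) := by
  have hfin : ∫⁻ u, ENNReal.ofReal (opSize (Q u)) ^ α < ∞ :=
    (lintegral_opSize_le hα.le Q).trans_lt (ENNReal.mul_lt_top (by finiteness) hQ.2)
  obtain ⟨f, hf, hlim, hpt, hK⟩ := exists_simpleFunc_approx_pi hα
    (measurable_pi_lambda _ fun i => measurable_pi_lambda _ fun j => hQ.1 i j) hfin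
  let g : ℕ → SimpleFunc (Vec d) (Matrix (Fin m) (Fin m) ℂ) := f
  refine ⟨g, fun n => SimpleFunc.finMeasSupp_iff.2 (hf n), ?_, hpt, hK⟩
  have h0 : Tendsto (fun n => 2 * ∫⁻ u, ENNReal.ofReal (opSize (Q u - g n u)) ^ α) atTop (𝓝 0) := by
    have h := ENNReal.Tendsto.const_mul hlim (Or.inr (by norm_num : (2 : ℝ≥0∞) ≠ ∞))
    rw [mul_zero] at h
    exact h
  exact tendsto_of_tendsto_of_tendsto_of_le_of_le tendsto_const_nhds h0 (fun _ => zero_le)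
    fun n => alphaSize_le hα.le _

end AlphaSize

/-! ### Joint characteristic functions and the stochastic integral -/

section JointCharFun

variable {d m : ℕ} {Ω : Type*} [MeasurableSpace Ω] {P : Measure Ω} {α : ℝ}

/-- `∫ ‖∑ j, (G j u)ᵀ θ j‖ ^ α du`. -/
noncomputable def jointSize {k : ℕ} (α : ℝ) (θ : Fin k → Vec m)
    (G : Fin k → Vec d → Matrix (Fin m) (Fin m) ℂ) : ℝ≥0∞ :=
  ∫⁻ u, ‖∑ j, coef (θ j) (G j u)‖ₑ ^ α

/-- The joint characteristic function of `Y` is that of the stochastic integrals of `G`. -/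
def HasJointCharFun {k : ℕ} (α : ℝ) (P : Measure Ω) (Y : Fin k → Ω → Vec m)
    (G : Fin k → Vec d → Matrix (Fin m) (Fin m) ℂ) : Prop :=
  ∀ θ : Fin k → Vec m,
    ∫ ω, Complex.exp (((∑ j, ⟪θ j, Y j ω⟫ : ℝ) : ℂ) * Complex.I) ∂P =
      Complex.exp (-(((jointSize α θ G).toReal : ℝ) : ℂ))

lemma enorm_sum_coef_le {k : ℕ} (θ : Fin k → Vec m) (C : Fin k → Matrix (Fin m) (Fin m) ℂ) :
    ‖∑ j, coef (θ j) (C j)‖ₑ ≤ ∑ j, ENNReal.ofReal (‖θ j‖ * opSize (C j)) := by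
  rw [← ENNReal.ofReal_sum_of_nonneg fun j _ => mul_nonneg (norm_nonneg _) (opSize_nonneg _),
    ← ofReal_norm]
  exact ENNReal.ofReal_le_ofReal ((norm_sum_le _ _).trans
    (Finset.sum_le_sum fun j _ => norm_coef_le _ _))

lemma enorm_sum_coef_rpow_le (hα : 0 ≤ α) {k : ℕ} (hk : k ≠ 0) (θ : Fin k → Vec m)
    (C : Fin k → Matrix (Fin m) (Fin m) ℂ) :
    ‖∑ j, coef (θ j) (C j)‖ₑ ^ α ≤
      (k : ℝ≥0∞) ^ α * ∑ j, ENNReal.ofReal ‖θ j‖ ^ α * ENNReal.ofReal (opSize (C j)) ^ α := by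
  refine (ENNReal.rpow_le_rpow (enorm_sum_coef_le θ C) hα).trans
    ((ennreal_rpow_sum_le hα _ hk).trans_eq ?_)
  congr 1
  refine Finset.sum_congr rfl fun j _ => ?_
  rw [ENNReal.ofReal_mul (norm_nonneg _), ENNReal.mul_rpow_of_nonneg _ _ hα]

lemma lintegral_opSize_lt_top (hα : 0 ≤ α) {Q : Vec d → Matrix (Fin m) (Fin m) ℂ}
    (hQ : IsIntegrand α Q) : ∫⁻ u, ENNReal.ofReal (opSize (Q u)) ^ α < ∞ :=
  (lintegral_opSize_le hα Q).trans_lt (ENNReal.mul_lt_top (by finiteness) hQ.2)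

lemma measurable_opSize {Q : Vec d → Matrix (Fin m) (Fin m) ℂ}
    (hQ : ∀ i j, Measurable fun u => Q u i j) :
    Measurable fun u => ENNReal.ofReal (opSize (Q u)) ^ α :=
  (measurable_comp_of_continuous continuous_opSize hQ).ennreal_ofReal.pow_const α

lemma measurable_enorm_sum_coef {k : ℕ} (θ : Fin k → Vec m)
    {G : Fin k → Vec d → Matrix (Fin m) (Fin m) ℂ}
    (hG : ∀ l i j, Measurable fun u => G l u i j) :
    Measurable fun u => ‖∑ j, coef (θ j) (G j u)‖ₑ ^ α :=
  (Finset.measurable_sum _ fun j _ =>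
    measurable_comp_of_continuous (continuous_coef (θ j)) (hG j)).enorm.pow_const α

/-- Integrability of the bound in `enorm_sum_coef_rpow_le`. -/
lemma lintegral_sum_opSize_lt_top (hα : 0 ≤ α) {k : ℕ} (θ : Fin k → Vec m)
    {G : Fin k → Vec d → Matrix (Fin m) (Fin m) ℂ} (hG : ∀ j, IsIntegrand α (G j)) :
    ∫⁻ u, (k : ℝ≥0∞) ^ α * ∑ j, ENNReal.ofReal ‖θ j‖ ^ α * ENNReal.ofReal (opSize (G j u)) ^ α
      < ∞ := by
  rw [lintegral_const_mul' _ _ (by finiteness), lintegral_finsetSum]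
  · refine ENNReal.mul_lt_top (by finiteness) (ENNReal.sum_lt_top.2 fun j _ => ?_)
    rw [lintegral_const_mul' _ _ (by finiteness)]
    exact ENNReal.mul_lt_top (by finiteness) (lintegral_opSize_lt_top hα (hG j))
  · exact fun j _ => (measurable_opSize (hG j).1).const_mul _

lemma jointSize_lt_top (hα : 0 < α) {k : ℕ} (θ : Fin k → Vec m)
    {G : Fin k → Vec d → Matrix (Fin m) (Fin m) ℂ} (hG : ∀ j, IsIntegrand α (G j)) :
    jointSize α θ G < ∞ := by
  rcases Nat.eq_zero_or_pos k with rfl | hk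
  · simp [jointSize, hα]
  · exact (lintegral_mono fun u => enorm_sum_coef_rpow_le hα.le hk.ne' θ fun j => G j u).trans_lt
      (lintegral_sum_opSize_lt_top hα.le θ hG)

variable {M : Set (Vec d) → Ω → EuclideanSpace ℝ (Fin m ⊕ Fin m)}

lemma volume_fiber_lt_top {f : SimpleFunc (Vec d) (Matrix (Fin m) (Fin m) ℂ)}
    (hf : f.FinMeasSupp volume) (θ : Vec m) (C : Matrix (Fin m) (Fin m) ℂ) (hC : coef θ C ≠ 0) :
    volume (f ⁻¹' {C}) < ∞ :=
  SimpleFunc.finMeasSupp_iff.1 hf C fun h => hC (h ▸ coef_zero_right θ)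

lemma measurable_reSimpleIntegral
    (hM : IsStableRandomMeasure α (controlMeasure d (Fin m ⊕ Fin m) α) P M)
    {f : SimpleFunc (Vec d) (Matrix (Fin m) (Fin m) ℂ)} (hf : f.FinMeasSupp volume) :
    Measurable (reSimpleIntegral M f) := by
  have h : ∀ i, Measurable fun ω => reSimpleIntegral M f ω i := fun i => by
    have h1 : (fun ω => reSimpleIntegral M f ω i) =
        pairing M (coef (EuclideanSpace.single i 1)) f := funext fun ω => by
      rw [← inner_reSimpleIntegral, EuclideanSpace.inner_single_left]
      simp
    rw [h1]
    exact measurable_pairing hM f _ (volume_fiber_lt_top hf _)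
  exact (MeasurableEquiv.toLp 2 (Fin m → ℝ)).measurable.comp (measurable_pi_lambda _ h)

/-- The simple function with components `f j`. -/
def simpleFuncPi {X W : Type*} [MeasurableSpace X] {k : ℕ} (f : Fin k → SimpleFunc X W) :
    SimpleFunc X (Fin k → W) where
  toFun u j := f j u
  measurableSet_fiber' w := by
    have h : (fun u j => f j u) ⁻¹' {w} = ⋂ j, f j ⁻¹' {w j} := by
      ext u
      simp [funext_iff]
    rw [h]
    exact MeasurableSet.iInter fun j => (f j).measurableSet_fiber _
  finite_range' := by
    refine (Set.Finite.pi' fun j => (f j).finite_range).subset ?_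
    rintro _ ⟨u, rfl⟩ j
    exact ⟨u, rfl⟩

/-- On the common refinement given by `simpleFuncPi`, the functional `∑ ⟪θ j, ·⟫` of the integrals
is almost surely a single pairing. -/
lemma hasJointCharFun_reSimpleIntegral [IsProbabilityMeasure P] (hα : 0 < α)
    (hM : IsStableRandomMeasure α (controlMeasure d (Fin m ⊕ Fin m) α) P M) {k : ℕ}
    {f : Fin k → SimpleFunc (Vec d) (Matrix (Fin m) (Fin m) ℂ)}
    (hf : ∀ j, (f j).FinMeasSupp volume) :
    HasJointCharFun α P (fun j => reSimpleIntegral M (f j)) (fun j u => f j u) := by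
  intro θ
  set F := simpleFuncPi f with hF
  set L : (Fin k → Matrix (Fin m) (Fin m) ℂ) → EuclideanSpace ℝ (Fin m ⊕ Fin m) :=
    fun w => ∑ j, coef (θ j) (w j) with hL
  have hmap : ∀ j, F.map (fun w => w j) = f j := fun j => SimpleFunc.ext fun u => rfl
  have hfib : ∀ w j, w j ≠ 0 → volume (F ⁻¹' {w}) < ∞ := fun w j hw => by
    refine (measure_mono fun u hu => ?_).trans_lt (SimpleFunc.finMeasSupp_iff.1 (hf j) (w j) hw)
    have hu' : (fun j => f j u) = w := hu
    exact congrFun hu' j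
  have h1 : ∀ᵐ ω ∂P, ∀ j, pairing M (coef (θ j)) (f j) ω =
      pairing M (fun w => coef (θ j) (w j)) F ω := by
    refine ae_all_iff.2 fun j => ?_
    have h := pairing_map hα hM F (fun w => w j) (coef (θ j)) fun w hw =>
      hfib w j fun h0 => hw (by simp [h0, coef_zero_right])
    rw [hmap] at h
    exact h
  have h2 : ∀ᵐ ω ∂P, Complex.exp (((∑ j, ⟪θ j, reSimpleIntegral M (f j) ω⟫ : ℝ) : ℂ) * Complex.I) =
      Complex.exp ((pairing M L F ω : ℂ) * Complex.I) := by
    filter_upwards [h1] with ω hω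
    congr 3
    simp_rw [inner_reSimpleIntegral, hω, pairing, hL, inner_sum]
    exact Finset.sum_comm
  rw [integral_congr_ae h2, integral_exp_pairing hα hM F L fun w hw => ?_]
  · rfl
  · by_contra hinf
    refine hw (Finset.sum_eq_zero fun j _ => ?_)
    by_cases h0 : w j = 0
    · rw [h0, coef_zero_right]
    · exact absurd (hfib w j h0) hinf

lemma tendstoInMeasure_pi {k : ℕ} {Y : ℕ → Fin k → Ω → Vec m} {X : Fin k → Ω → Vec m}
    (h : ∀ j, TendstoInMeasure P (fun n => Y n j) atTop (X j)) :
    TendstoInMeasure P (fun n ω j => Y n j ω) atTop (fun ω j => X j ω) := by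
  intro ε hε
  have h1 : Tendsto (fun n => ∑ j, P {ω | ε ≤ edist (Y n j ω) (X j ω)}) atTop (𝓝 (∑ _j : Fin k, 0)) :=
    tendsto_finsetSum _ fun j _ => h j ε hε
  rw [Finset.sum_const_zero] at h1
  refine tendsto_of_tendsto_of_tendsto_of_le_of_le tendsto_const_nhds h1 (fun _ => zero_le)
    fun n => ?_
  refine (measure_mono fun ω hω => ?_).trans (measure_iUnion_fintype_le P _)
  by_contra hcon
  simp only [Set.mem_iUnion, Set.mem_ofPred_eq, not_exists, not_le] at hcon hω
  refine absurd hω (not_le.2 ?_)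
  rw [edist_pi_def, Finset.sup_lt_iff hε]
  exact fun j _ => hcon j

/-- Both sides of the formula for simple functions pass to the limit: the left along an almost
surely convergent subsequence with bounded integrand, the right by domination of the approximants by
`Q`. -/
lemma HasJointCharFun.of_isReIntegral [IsProbabilityMeasure P] (hα : 0 < α)
    (hM : IsStableRandomMeasure α (controlMeasure d (Fin m ⊕ Fin m) α) P M) {k : ℕ}
    {Q : Fin k → Vec d → Matrix (Fin m) (Fin m) ℂ} {X : Fin k → Ω → Vec m}
    (hX : ∀ j, IsReIntegral α P M (Q j) (X j)) : HasJointCharFun α P X Q := by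
  intro θ
  choose f hf hlim hpt K hK hKb using fun j => exists_simpleFunc_approx hα (hX j).integrand
  have hconv : TendstoInMeasure P (fun n ω j => reSimpleIntegral M (f j n) ω) atTop
      (fun ω j => X j ω) :=
    tendstoInMeasure_pi (Y := fun n j => reSimpleIntegral M (f j n)) fun j =>
      (hX j).tendsto (f j) (hf j) (hlim j)
  obtain ⟨ns, hns, hae⟩ := hconv.exists_seq_tendsto_ae
  have hleft : Tendsto (fun n => ∫ ω, Complex.exp
      (((∑ j, ⟪θ j, reSimpleIntegral M (f j (ns n)) ω⟫ : ℝ) : ℂ) * Complex.I) ∂P) atTop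
      (𝓝 (∫ ω, Complex.exp (((∑ j, ⟪θ j, X j ω⟫ : ℝ) : ℂ) * Complex.I) ∂P)) := by
    refine tendsto_integral_of_dominated_convergence (fun _ => 1) (fun n => ?_)
      (integrable_const _) (fun n => Eventually.of_forall fun ω => ?_) ?_
    · refine Measurable.aestronglyMeasurable ?_
      have : ∀ j, Measurable fun ω => ⟪θ j, reSimpleIntegral M (f j (ns n)) ω⟫ := fun j =>
        (measurable_reSimpleIntegral hM (hf j (ns n))).const_inner
      fun_prop
    · rw [Complex.norm_exp_ofReal_mul_I]
    · filter_upwards [hae] with ω hω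
      rw [tendsto_pi_nhds] at hω
      refine (Complex.continuous_exp.tendsto _).comp (Tendsto.mul_const _
        ((Complex.continuous_ofReal.tendsto _).comp (tendsto_finsetSum _ fun j _ => ?_)))
      exact tendsto_const_nhds.inner (hω j)
  have hsize : Tendsto (fun n => jointSize α θ fun j u => f j n u) atTop (𝓝 (jointSize α θ Q)) := by
    rcases Nat.eq_zero_or_pos k with rfl | hk
    · simp [jointSize]
    refine tendsto_lintegral_of_dominated_convergence
      -- The domination constant `K j` is moved onto `θ j`, so that the majorant has the form
      -- already known to be integrable.
      (fun u => (k : ℝ≥0∞) ^ α * ∑ j, ENNReal.ofReal ‖(K j) • θ j‖ ^ α *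
        ENNReal.ofReal (opSize (Q j u)) ^ α) (fun n => ?_)
      (fun n => Eventually.of_forall fun u => ?_)
      (lintegral_sum_opSize_lt_top hα.le _ fun j => (hX j).integrand).ne
      (Eventually.of_forall fun u => ?_)
    · exact measurable_enorm_sum_coef θ fun l i j =>
        (SimpleFunc.map (fun C : Matrix (Fin m) (Fin m) ℂ => C i j) (f l n)).measurable
    · refine (enorm_sum_coef_rpow_le hα.le hk.ne' θ fun j => f j n u).trans ?_
      refine mul_le_mul_right (Finset.sum_le_sum fun j _ => ?_) _
      rw [← ENNReal.mul_rpow_of_nonneg _ _ hα.le, ← ENNReal.mul_rpow_of_nonneg _ _ hα.le,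
        ← ENNReal.ofReal_mul (norm_nonneg _), ← ENNReal.ofReal_mul (norm_nonneg _), norm_smul,
        Real.norm_of_nonneg (hK j), mul_comm (K j), mul_assoc]
      gcongr
      exact hKb j n u
    · refine ((ENNReal.continuous_rpow_const (y := α)).tendsto _).comp
        ((continuous_enorm.tendsto _).comp (tendsto_finsetSum _ fun j _ => ?_))
      exact ((continuous_coef (θ j)).tendsto _).comp (hpt j u)
  have hright : Tendsto (fun n => Complex.exp
      (-(((jointSize α θ fun j u => f j (ns n) u).toReal : ℝ) : ℂ))) atTop
      (𝓝 (Complex.exp (-(((jointSize α θ Q).toReal : ℝ) : ℂ)))) := by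
    have h1 := (ENNReal.tendsto_toReal
      (jointSize_lt_top hα θ fun j => (hX j).integrand).ne).comp
      (hsize.comp hns.tendsto_atTop)
    exact (Complex.continuous_exp.tendsto _).comp
      ((Complex.continuous_ofReal.tendsto _).comp h1).neg
  refine tendsto_nhds_unique hleft (hright.congr fun n => ?_)
  exact (hasJointCharFun_reSimpleIntegral hα hM (fun j => hf j (ns n)) θ).symm

/-- The difference of two integrals is small in probability if the integrands are close. -/
lemma exists_measure_le_norm_sub_le [IsProbabilityMeasure P] (hα : 0 < α) {ε : ℝ} (hε : 0 < ε) :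
    ∃ C : ℝ≥0∞, C ≠ ∞ ∧ ∀ (Y : Fin 2 → Ω → Vec m) (G : Fin 2 → Vec d → Matrix (Fin m) (Fin m) ℂ),
      (∀ j, Measurable (Y j)) → HasJointCharFun α P Y G →
      P {ω | ε ≤ ‖Y 0 ω - Y 1 ω‖} ≤ C * alphaSize α (fun u => G 0 u - G 1 u) := by
  -- If all `m` coordinates are at most `r`, the norm is at most `m r < ε`; the `+ 1` also covers `m
  -- = 0`.
  set r : ℝ := ε / (m + 1) with hr
  have hr0 : 0 < r := by positivity
  refine ⟨m * (ENNReal.ofReal (2 * (2 / r) ^ α) * 2 ^ α), by finiteness, fun Y G hY hG => ?_⟩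
  rcases eq_or_ne (alphaSize α fun u => G 0 u - G 1 u) ∞ with htop | hfin
  · rcases Nat.eq_zero_or_pos m with rfl | hm
    · have : {ω | ε ≤ ‖Y 0 ω - Y 1 ω‖} = ∅ := by
        ext ω
        have h0 : Y 0 ω - Y 1 ω = 0 := Subsingleton.elim _ _
        simpa [h0] using hε
      simp [this]
    · rw [htop, ENNReal.mul_top]
      · exact le_top
      · have : (0 : ℝ) < 2 * (2 / r) ^ α := by positivity
        simp only [ne_eq, mul_eq_zero, not_or]
        refine ⟨by exact_mod_cast hm.ne', (ENNReal.ofReal_pos.2 this).ne', ?_⟩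
        exact (ENNReal.rpow_pos (by norm_num) (by norm_num)).ne'
  have hcoord : ∀ i : Fin m, P {ω | r < |Y 0 ω i - Y 1 ω i|} ≤
      ENNReal.ofReal (2 * (2 / r) ^ α) * (2 ^ α * alphaSize α (fun u => G 0 u - G 1 u)) := by
    intro i
    set e : Vec m := EuclideanSpace.single i 1 with he
    set c := ∫⁻ u, ‖coef e (G 0 u - G 1 u)‖ₑ ^ α with hc
    have hcle : c ≤ 2 ^ α * alphaSize α (fun u => G 0 u - G 1 u) := by
      refine (lintegral_mono fun u => ?_).trans (lintegral_opSize_le hα.le _)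
      rw [← ofReal_norm]
      gcongr
      exact (norm_coef_le _ _).trans_eq (by simp [he])
    have hcfin : c ≠ ∞ := ne_top_of_le_ne_top (by finiteness) hcle
    have hZ : Measurable fun ω => Y 0 ω i - Y 1 ω i := by
      have := hY 0
      have := hY 1
      fun_prop
    have hchar : ∀ t : ℝ, ∫ ω, Complex.exp (((t * (Y 0 ω i - Y 1 ω i) : ℝ) : ℂ) * Complex.I) ∂P =
        Complex.exp (-((|t| ^ α * c.toReal : ℝ) : ℂ)) := by
      intro t
      -- Opposite test vectors isolate one coordinate of `Y 0 - Y 1`, and the coefficients combine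
      -- into that of `G 0 - G 1`.
      have h := hG ![t • e, -(t • e)]
      have hsize : jointSize α ![t • e, -(t • e)] G = ENNReal.ofReal (|t| ^ α) * c := by
        rw [jointSize, hc, ← lintegral_const_mul' _ _ ENNReal.ofReal_ne_top]
        refine lintegral_congr fun u => ?_
        simp only [Fin.sum_univ_two, Matrix.cons_val_zero, Matrix.cons_val_one]
        rw [coef_neg_left, coef_smul_left, coef_smul_left, ← sub_eq_add_neg, ← smul_sub,
          ← coef_sub_right, enorm_smul, ENNReal.mul_rpow_of_nonneg _ _ hα.le,
          Real.enorm_eq_ofReal_abs, ENNReal.ofReal_rpow_of_nonneg (abs_nonneg _) hα.le]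
      rw [hsize, ENNReal.toReal_mul, ENNReal.toReal_ofReal (by positivity)] at h
      rw [← h]
      congr 1
      funext ω
      congr 3
      simp [Fin.sum_univ_two, inner_smul_left, he, EuclideanSpace.inner_single_left]
      ring
    have h := measureReal_abs_gt_le_of_charFun hα ENNReal.toReal_nonneg hZ hchar hr0
    rw [measureReal_def] at h
    calc P {ω | r < |Y 0 ω i - Y 1 ω i|}
        = ENNReal.ofReal (P {ω | r < |Y 0 ω i - Y 1 ω i|}).toReal :=
          (ENNReal.ofReal_toReal (measure_ne_top _ _)).symm
      _ ≤ ENNReal.ofReal (2 * (2 / r) ^ α * c.toReal) := ENNReal.ofReal_le_ofReal h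
      _ = ENNReal.ofReal (2 * (2 / r) ^ α) * c := by
          rw [ENNReal.ofReal_mul (by positivity), ENNReal.ofReal_toReal hcfin]
      _ ≤ _ := by gcongr
  have hsub : {ω | ε ≤ ‖Y 0 ω - Y 1 ω‖} ⊆ ⋃ i : Fin m, {ω | r < |Y 0 ω i - Y 1 ω i|} := by
    intro ω hω
    by_contra hcon
    simp only [Set.mem_iUnion, Set.mem_ofPred_eq, not_exists, not_lt] at hcon hω
    have h1 : ‖Y 0 ω - Y 1 ω‖ ≤ m * r := by
      calc ‖Y 0 ω - Y 1 ω‖ = ‖∑ i, EuclideanSpace.single i ((Y 0 ω - Y 1 ω) i)‖ := by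
            congr 1
            ext j
            simp
        _ ≤ ∑ i, ‖EuclideanSpace.single i ((Y 0 ω - Y 1 ω) i)‖ := norm_sum_le _ _
        _ ≤ ∑ _i : Fin m, r := Finset.sum_le_sum fun i _ => by simpa using hcon i
        _ = m * r := by simp
    have h2 : (m : ℝ) * r < ε := by
      rw [hr, mul_div_assoc', div_lt_iff₀ (by positivity)]
      nlinarith
    linarith
  calc P {ω | ε ≤ ‖Y 0 ω - Y 1 ω‖} ≤ ∑ i : Fin m, P {ω | r < |Y 0 ω i - Y 1 ω i|} :=
        (measure_mono hsub).trans (measure_iUnion_fintype_le P _)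
    _ ≤ ∑ _i : Fin m, ENNReal.ofReal (2 * (2 / r) ^ α) *
          (2 ^ α * alphaSize α (fun u => G 0 u - G 1 u)) := Finset.sum_le_sum fun i _ => hcoord i
    _ = _ := by simp [mul_assoc]

/-- A quasi-triangle inequality through `Q`. The factor `2` and one `2 ^ α` convert between
`alphaSize` and `opSize`; the other `2 ^ α` splits the power of a sum. -/
lemma alphaSize_sub_le (hα : 0 < α) (Q : Vec d → Matrix (Fin m) (Fin m) ℂ)
    {Q₁ : Vec d → Matrix (Fin m) (Fin m) ℂ} (h₁ : ∀ i j, Measurable fun u => (Q u - Q₁ u) i j)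
    (Q₂ : Vec d → Matrix (Fin m) (Fin m) ℂ)  :
    alphaSize α (fun u => Q₁ u - Q₂ u) ≤ 2 * 2 ^ α * 2 ^ α *
      (alphaSize α (fun u => Q u - Q₁ u) + alphaSize α (fun u => Q u - Q₂ u)) := by
  calc alphaSize α (fun u => Q₁ u - Q₂ u)
      ≤ 2 * ∫⁻ u, ENNReal.ofReal (opSize (Q₁ u - Q₂ u)) ^ α := alphaSize_le hα.le _
    _ ≤ 2 * ∫⁻ u, 2 ^ α * (ENNReal.ofReal (opSize (Q u - Q₁ u)) ^ α +
          ENNReal.ofReal (opSize (Q u - Q₂ u)) ^ α) := by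
        gcongr with u
        refine (ENNReal.rpow_le_rpow ?_ hα.le).trans (ennreal_rpow_add_le hα.le _ _)
        rw [← ENNReal.ofReal_add (opSize_nonneg _) (opSize_nonneg _), add_comm]
        refine ENNReal.ofReal_le_ofReal ?_
        have h := opSize_sub_le (Q u - Q₂ u) (Q u - Q₁ u)
        rwa [sub_sub_sub_cancel_left] at h
    _ ≤ 2 * (2 ^ α * (2 ^ α * alphaSize α (fun u => Q u - Q₁ u) +
          2 ^ α * alphaSize α (fun u => Q u - Q₂ u))) := by
        rw [lintegral_const_mul' _ _ (by finiteness), lintegral_add_left (measurable_opSize h₁)]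
        gcongr <;> exact lintegral_opSize_le hα.le _
    _ = _ := by ring

lemma exists_measure_reSimpleIntegral_le [IsProbabilityMeasure P] (hα : 0 < α)
    (hM : IsStableRandomMeasure α (controlMeasure d (Fin m ⊕ Fin m) α) P M)
    {Q : Vec d → Matrix (Fin m) (Fin m) ℂ} (hQ : ∀ i j, Measurable fun u => Q u i j)
    {ε : ℝ} (hε : 0 < ε) :
    ∃ C : ℝ≥0∞, C ≠ ∞ ∧ ∀ f g : SimpleFunc (Vec d) (Matrix (Fin m) (Fin m) ℂ),
      f.FinMeasSupp volume → g.FinMeasSupp volume →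
      P {ω | ε ≤ ‖reSimpleIntegral M f ω - reSimpleIntegral M g ω‖} ≤
        C * (alphaSize α (fun u => Q u - f u) + alphaSize α (fun u => Q u - g u)) := by
  obtain ⟨C, hC, h⟩ := exists_measure_le_norm_sub_le (d := d) (m := m) (P := P) hα hε
  refine ⟨C * (2 * 2 ^ α * 2 ^ α), by finiteness, fun f g hf hg => ?_⟩
  have hfg : ∀ j, (![f, g] j).FinMeasSupp volume := fun j => by fin_cases j <;> assumption
  have h1 := h _ _ (fun j => measurable_reSimpleIntegral hM (hfg j))
    (hasJointCharFun_reSimpleIntegral hα hM hfg)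
  refine h1.trans ?_
  rw [mul_assoc]
  gcongr
  refine alphaSize_sub_le hα Q (fun i j => ?_) g
  exact (hQ i j).sub (SimpleFunc.map (fun C : Matrix (Fin m) (Fin m) ℂ => C i j) f).measurable

/-- Existence of the stochastic integral. -/
lemma exists_isReIntegral [IsProbabilityMeasure P] (hα : 0 < α)
    (hM : IsStableRandomMeasure α (controlMeasure d (Fin m ⊕ Fin m) α) P M)
    {Q : Vec d → Matrix (Fin m) (Fin m) ℂ} (hQ : IsIntegrand α Q) :
    ∃ X : Ω → Vec m, IsReIntegral α P M Q X := by
  obtain ⟨f, hf, hlim, -, -⟩ := exists_simpleFunc_approx hα hQ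
  obtain ⟨X, hX, hXlim⟩ := exists_tendstoInMeasure_of_cauchy (P := P)
    (fun n => measurable_reSimpleIntegral hM (hf n)) hlim fun ε hε => by
      obtain ⟨C, hC, h⟩ := exists_measure_reSimpleIntegral_le hα hM hQ.1 hε
      exact ⟨C, hC, fun n p => h _ _ (hf n) (hf p)⟩
  refine ⟨X, hQ, hX, fun g hg hglim => ?_⟩
  rw [tendstoInMeasure_iff_norm] at hXlim ⊢
  intro ε hε
  -- An arbitrary approximating sequence `g` is close in probability to the fixed sequence `f` that
  -- produced `X`.
  obtain ⟨C, hC, h⟩ := exists_measure_reSimpleIntegral_le hα hM hQ.1 (half_pos hε)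
  have h1 : Tendsto (fun n => C * (alphaSize α (fun u => Q u - g n u) +
      alphaSize α (fun u => Q u - f n u)) +
      P {ω | ε / 2 ≤ ‖reSimpleIntegral M (f n) ω - X ω‖}) atTop (𝓝 (C * (0 + 0) + 0)) :=
    (ENNReal.Tendsto.const_mul (hglim.add hlim) (Or.inr hC)).add (hXlim _ (half_pos hε))
  rw [add_zero, add_zero, mul_zero] at h1
  refine tendsto_of_tendsto_of_tendsto_of_le_of_le tendsto_const_nhds h1 (fun _ => zero_le)
    fun n => ?_
  exact (measure_le_norm_sub_le _ (reSimpleIntegral M (f n)) X ε).trans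
    (add_le_add (h _ _ (hg n) (hf n)) le_rfl)

lemma IsReIntegral.ae_eq (hα : 0 < α) {Q : Vec d → Matrix (Fin m) (Fin m) ℂ} {X X' : Ω → Vec m}
    (hX : IsReIntegral α P M Q X) (hX' : IsReIntegral α P M Q X') : X =ᵐ[P] X' := by
  obtain ⟨f, hf, hlim, -, -⟩ := exists_simpleFunc_approx hα hX.integrand
  exact tendstoInMeasure_ae_unique (hX.tendsto f hf hlim) (hX'.tendsto f hf hlim)

end JointCharFun

/-! ### Laws determined by joint characteristic functions -/

section FiniteDimensionalDistributions

variable {m : ℕ} {Ω : Type*} [MeasurableSpace Ω] {P : Measure Ω}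

lemma exists_dual_eq_sum_inner {k : ℕ} (L : StrongDual ℝ (Fin k → Vec m)) :
    ∃ θ : Fin k → Vec m, ∀ x, L x = ∑ j, ⟪θ j, x j⟫ := by
  refine ⟨fun j => (InnerProductSpace.toDual ℝ (Vec m)).symm
    (L.comp (ContinuousLinearMap.single ℝ (fun _ : Fin k => Vec m) j)), fun x => ?_⟩
  simp only [InnerProductSpace.toDual_symm_apply, ContinuousLinearMap.comp_apply]
  rw [← map_sum]
  congr 1
  funext i
  rw [Finset.sum_apply]
  simp [Pi.single_apply]

lemma identDistrib_of_integral_exp_eq [IsProbabilityMeasure P] {k : ℕ} {X Y : Fin k → Ω → Vec m}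
    (hX : ∀ j, Measurable (X j)) (hY : ∀ j, Measurable (Y j))
    (h : ∀ θ : Fin k → Vec m,
      ∫ ω, Complex.exp (((∑ j, ⟪θ j, X j ω⟫ : ℝ) : ℂ) * Complex.I) ∂P =
        ∫ ω, Complex.exp (((∑ j, ⟪θ j, Y j ω⟫ : ℝ) : ℂ) * Complex.I) ∂P) :
    IdentDistrib (fun ω j => X j ω) (fun ω j => Y j ω) P P := by
  have hXm : Measurable fun ω j => X j ω := measurable_pi_lambda _ hX
  have hYm : Measurable fun ω j => Y j ω := measurable_pi_lambda _ hY
  refine ⟨hXm.aemeasurable, hYm.aemeasurable, Measure.ext_of_charFunDual (funext fun L => ?_)⟩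
  obtain ⟨θ, hθ⟩ := exists_dual_eq_sum_inner L
  rw [charFunDual_apply, charFunDual_apply, integral_map hXm.aemeasurable (by fun_prop),
    integral_map hYm.aemeasurable (by fun_prop)]
  simp_rw [hθ]
  exact h θ

variable {d : ℕ} {α : ℝ}

lemma jointSize_smul (hα : 0 < α) {k : ℕ} (c : ℝ) (θ : Fin k → Vec m)
    (G : Fin k → Vec d → Matrix (Fin m) (Fin m) ℂ) :
    jointSize α (fun j => c • θ j) G = ENNReal.ofReal (|c| ^ α) * jointSize α θ G := by
  rw [jointSize, jointSize, ← lintegral_const_mul' _ _ ENNReal.ofReal_ne_top]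
  refine lintegral_congr fun u => ?_
  simp_rw [coef_smul_left]
  rw [← Finset.smul_sum, enorm_smul, ENNReal.mul_rpow_of_nonneg _ _ hα.le,
    Real.enorm_eq_ofReal_abs, ENNReal.ofReal_rpow_of_nonneg (abs_nonneg _) hα.le]

/-- Scalings of a law with stable joint characteristic function. -/
lemma HasJointCharFun.charFunDual_map_smul (hα : 0 < α) {k : ℕ} {X : Fin k → Ω → Vec m}
    {G : Fin k → Vec d → Matrix (Fin m) (Fin m) ℂ} (hX : ∀ j, Measurable (X j))
    (h : HasJointCharFun α P X G) {L : StrongDual ℝ (Fin k → Vec m)} {θ : Fin k → Vec m}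
    (hθ : ∀ x, L x = ∑ j, ⟪θ j, x j⟫) (c : ℝ) :
    charFunDual ((P.map fun ω j => X j ω).map fun v => c • v) L =
      Complex.exp (-((|c| ^ α * (jointSize α θ G).toReal : ℝ) : ℂ)) := by
  have hXm : Measurable fun ω j => X j ω := measurable_pi_lambda _ hX
  have hcm : Measurable fun v : Fin k → Vec m => c • v := measurable_const_smul c
  have h1 := h fun j => c • θ j
  rw [jointSize_smul hα, ENNReal.toReal_mul, ENNReal.toReal_ofReal (by positivity)] at h1
  rw [← h1, charFunDual_apply, integral_map hcm.aemeasurable (by fun_prop),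
    integral_map hXm.aemeasurable (by fun_prop)]
  simp_rw [hθ, Pi.smul_apply, inner_smul_left, inner_smul_right, conj_trivial]

/-- The exponent is even and `α`-homogeneous in the test vector. Convolution adds exponents, giving
`|a| ^ α + |b| ^ α`, the `α`-th power of the required scale. -/
lemma HasJointCharFun.isSymmetricStable [IsProbabilityMeasure P] (hα : 0 < α) {k : ℕ}
    {X : Fin k → Ω → Vec m} {G : Fin k → Vec d → Matrix (Fin m) (Fin m) ℂ}
    (hX : ∀ j, Measurable (X j)) (h : HasJointCharFun α P X G) :
    IsSymmetricStable α (P.map fun ω j => X j ω) where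
  symmetric := by
    refine Measure.ext_of_charFunDual (funext fun L => ?_)
    obtain ⟨θ, hθ⟩ := exists_dual_eq_sum_inner L
    have h1 := h.charFunDual_map_smul hα hX hθ (-1)
    have h2 := h.charFunDual_map_smul hα hX hθ 1
    simp only [neg_smul, one_smul, Measure.map_id', abs_neg] at h1 h2
    rw [h1, h2]
  stable a b ha hb := by
    refine Measure.ext_of_charFunDual (funext fun L => ?_)
    obtain ⟨θ, hθ⟩ := exists_dual_eq_sum_inner L
    have hab : |(a ^ α + b ^ α) ^ (1 / α)| ^ α = |a| ^ α + |b| ^ α := by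
      rw [abs_of_nonneg (by positivity), abs_of_pos ha, abs_of_pos hb,
        ← Real.rpow_mul (by positivity), one_div, inv_mul_cancel₀ hα.ne', Real.rpow_one]
    rw [charFunDual_conv, h.charFunDual_map_smul hα hX hθ, h.charFunDual_map_smul hα hX hθ,
      h.charFunDual_map_smul hα hX hθ, hab, ← Complex.exp_add]
    congr 1
    push_cast
    ring

end FiniteDimensionalDistributions

/-! ### The harmonizable kernel -/

section HarmonizableKernel

variable {d m : ℕ} {α : ℝ} {E : Matrix (Fin d) (Fin d) ℝ} {D : Matrix (Fin m) (Fin m) ℝ}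
  {ψ : Vec d → ℝ}

lemma coef_sum_left {k : ℕ} (θ : Fin k → Vec m) (C : Matrix (Fin m) (Fin m) ℂ) :
    coef (∑ j, θ j) C = ∑ j, coef (θ j) C := by
  ext l
  rcases l with l | l <;> simp [coef, Finset.sum_mul] <;> exact Finset.sum_comm

/-- Moves a matrix applied to the field onto the kernel; used with `r ^ D`. -/
lemma coef_op_transpose (A : Matrix (Fin m) (Fin m) ℝ) (θ : Vec m)
    (C : Matrix (Fin m) (Fin m) ℂ) :
    coef (op Aᵀ θ) C = coef θ (A.map (fun t : ℝ => (t : ℂ)) * C) := by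
  have happ : ∀ i : Fin m, (op Aᵀ θ) i = ∑ l, θ l * A l i := by
    intro k
    have h : (op Aᵀ θ) k = (Aᵀ *ᵥ (WithLp.ofLp θ)) k := rfl
    rw [h]
    simp [Matrix.mulVec, dotProduct, mul_comm]
  ext l
  rcases l with l | l
  all_goals
    simp only [coef, happ, Matrix.mul_apply, Matrix.map_apply, Complex.re_sum, Complex.im_sum,
      Complex.re_ofReal_mul, Complex.im_ofReal_mul, Sum.elim_inl, Sum.elim_inr, Finset.sum_mul,
      Finset.mul_sum, mul_assoc]
    rw [Finset.sum_comm]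

lemma opSize_smul_map (c : ℂ) (B : Matrix (Fin m) (Fin m) ℝ) :
    opSize (c • B.map (fun t : ℝ => (t : ℂ))) = (|c.re| + |c.im|) * ‖op B‖ := by
  have hre : (c • B.map (fun t : ℝ => (t : ℂ))).map Complex.re = c.re • B := by
    ext i j
    simp
  have him : (c • B.map (fun t : ℝ => (t : ℂ))).map Complex.im = c.im • B := by
    ext i j
    simp
  rw [opSize, hre, him, op_smul, op_smul, norm_smul, norm_smul, Real.norm_eq_abs, Real.norm_eq_abs,
    add_mul]

lemma opSize_smul_map_le (c : ℂ) (B : Matrix (Fin m) (Fin m) ℝ) :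
    opSize (c • B.map (fun t : ℝ => (t : ℂ))) ≤ 2 * (‖c‖ * ‖op B‖) := by
  rw [opSize_smul_map]
  nlinarith [Complex.abs_re_le_norm c, Complex.abs_im_le_norm c, norm_nonneg (op B)]

/-- Separates `x` from `y` in `|e^{is} - 1| ≤ min(2, |s|)`, so that one integrable function of `y`
serves every `x`. -/
lemma norm_exp_inner_sub_one_le (x y : Vec d) :
    ‖Complex.exp (Complex.I * ((⟪x, y⟫ : ℝ) : ℂ)) - 1‖ ≤ max 1 ‖x‖ * min 2 ‖y‖ := by
  have h1 : ‖Complex.exp (Complex.I * ((⟪x, y⟫ : ℝ) : ℂ)) - 1‖ ≤ 2 := by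
    refine (norm_sub_le _ _).trans ?_
    rw [Complex.norm_exp_I_mul_ofReal]
    norm_num
  have h2 : ‖Complex.exp (Complex.I * ((⟪x, y⟫ : ℝ) : ℂ)) - 1‖ ≤ ‖x‖ * ‖y‖ :=
    (Real.norm_exp_I_mul_ofReal_sub_one_le).trans (norm_inner_le_norm x y)
  rcases le_total 2 ‖y‖ with h | h
  · rw [min_eq_left h]
    linarith [le_max_left 1 ‖x‖]
  · rw [min_eq_right h]
    exact h2.trans (by gcongr; exact le_max_right _ _)

lemma opSize_harmonizableKernel_le (x y : Vec d) :
    opSize (harmonizableKernel α E D ψ x y) ≤ 2 * max 1 ‖x‖ * kernelBound α E D ψ y := by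
  refine (opSize_smul_map_le _ _).trans ?_
  rw [kernelBound, mul_assoc, ← mul_assoc (max 1 ‖x‖)]
  gcongr
  exact norm_exp_inner_sub_one_le x y

lemma measurable_harmonizableKernel (hψ : Continuous ψ) (x : Vec d) (i j : Fin m) :
    Measurable fun y => harmonizableKernel α E D ψ x y i j := by
  have h1 : Measurable fun y : Vec d => opPow (ψ y)
      (-D - (E.trace / α) • (1 : Matrix (Fin m) (Fin m) ℝ)) i j := by
    have hc : Continuous fun t : ℝ => NormedSpace.exp
        (t • (-D - (E.trace / α) • (1 : Matrix (Fin m) (Fin m) ℝ))) i j :=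
      (continuous_exp_smul _).matrix_elem i j
    exact hc.measurable.comp (Real.measurable_log.comp hψ.measurable)
  have h2 : Measurable fun y : Vec d => Complex.exp (Complex.I * ((⟪x, y⟫ : ℝ) : ℂ)) - 1 := by
    refine Continuous.measurable ?_
    fun_prop
  exact h2.mul (Complex.measurable_ofReal.comp h1)

lemma isIntegrand_harmonizableKernel (hα : 0 < α) (hψ : Continuous ψ)
    (hint : ∫⁻ y, ENNReal.ofReal (kernelBound α E D ψ y) ^ α < ∞) (x : Vec d) :
    IsIntegrand α (harmonizableKernel α E D ψ x) := by
  refine ⟨measurable_harmonizableKernel hψ x, (alphaSize_le hα.le _).trans_lt ?_⟩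
  refine ENNReal.mul_lt_top (by norm_num) ?_
  refine lt_of_le_of_lt (b := ∫⁻ y, ENNReal.ofReal (2 * max 1 ‖x‖) ^ α *
    ENNReal.ofReal (kernelBound α E D ψ y) ^ α) (lintegral_mono fun y => ?_) ?_
  · rw [← ENNReal.mul_rpow_of_nonneg _ _ hα.le, ← ENNReal.ofReal_mul (by positivity)]
    gcongr
    exact opSize_harmonizableKernel_le x y
  · rw [lintegral_const_mul' _ _ (by finiteness)]
    exact ENNReal.mul_lt_top (by finiteness) hint

lemma exp_inner_add (x h y : Vec d) :
    Complex.exp (Complex.I * ((⟪x + h, y⟫ : ℝ) : ℂ)) =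
      Complex.exp (Complex.I * ((⟪h, y⟫ : ℝ) : ℂ)) * Complex.exp (Complex.I * ((⟪x, y⟫ : ℝ) : ℂ)) := by
  rw [← Complex.exp_add, inner_add_left]
  congr 1
  push_cast
  ring

lemma harmonizableKernel_add_sub (x h y : Vec d) :
    harmonizableKernel α E D ψ (x + h) y - harmonizableKernel α E D ψ h y =
      Complex.exp (Complex.I * ((⟪h, y⟫ : ℝ) : ℂ)) • harmonizableKernel α E D ψ x y := by
  rw [harmonizableKernel, harmonizableKernel, harmonizableKernel, ← sub_smul, smul_smul,
    exp_inner_add]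
  congr 1
  ring

/-- The difference at `x` and `x₀` is, up to a phase, the kernel at `x - x₀`. On the unit ball
around `x₀` the factor `max 1 ‖x - x₀‖` is `1`, so a multiple of `kernelBound` dominates. -/
lemma tendsto_alphaSize_harmonizableKernel (hα : 0 < α) (hψ : Continuous ψ)
    (hint : ∫⁻ y, ENNReal.ofReal (kernelBound α E D ψ y) ^ α < ∞) (x₀ : Vec d) :
    Tendsto (fun x => alphaSize α fun y =>
      harmonizableKernel α E D ψ x y - harmonizableKernel α E D ψ x₀ y) (𝓝 x₀) (𝓝 0) := by
  have hdiff : ∀ x y, harmonizableKernel α E D ψ x y - harmonizableKernel α E D ψ x₀ y =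
      (Complex.exp (Complex.I * ((⟪x₀, y⟫ : ℝ) : ℂ)) *
        (Complex.exp (Complex.I * ((⟪x - x₀, y⟫ : ℝ) : ℂ)) - 1)) •
        (opPow (ψ y) (-D - (E.trace / α) • (1 : Matrix (Fin m) (Fin m) ℝ))).map
          (fun t : ℝ => (t : ℂ)) := by
    intro x y
    have h := harmonizableKernel_add_sub (α := α) (E := E) (D := D) (ψ := ψ) (x - x₀) x₀ y
    rw [sub_add_cancel] at h
    rw [h, harmonizableKernel, smul_smul]
  have hle : ∀ x y, opSize (harmonizableKernel α E D ψ x y - harmonizableKernel α E D ψ x₀ y) ≤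
      2 * (‖Complex.exp (Complex.I * ((⟪x - x₀, y⟫ : ℝ) : ℂ)) - 1‖ * ‖op (opPow (ψ y)
        (-D - (E.trace / α) • (1 : Matrix (Fin m) (Fin m) ℝ)))‖) := by
    intro x y
    rw [hdiff]
    refine (opSize_smul_map_le _ _).trans_eq ?_
    rw [norm_mul, Complex.norm_exp_I_mul_ofReal, one_mul]
  have h0 : Tendsto (fun x => ∫⁻ y, ENNReal.ofReal (opSize
      (harmonizableKernel α E D ψ x y - harmonizableKernel α E D ψ x₀ y)) ^ α) (𝓝 x₀)
      (𝓝 (∫⁻ _y : Vec d, 0)) := by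
    refine tendsto_lintegral_filter_of_dominated_convergence
      (fun y => ENNReal.ofReal 2 ^ α * ENNReal.ofReal (kernelBound α E D ψ y) ^ α)
      (Eventually.of_forall fun x => ?_) ?_ ?_ (Eventually.of_forall fun y => ?_)
    · exact measurable_opSize fun i j => (measurable_harmonizableKernel hψ x i j).sub
        (measurable_harmonizableKernel hψ x₀ i j)
    · filter_upwards [Metric.ball_mem_nhds x₀ one_pos] with x hx
      refine Eventually.of_forall fun y => ?_
      rw [← ENNReal.mul_rpow_of_nonneg _ _ hα.le, ← ENNReal.ofReal_mul (by positivity)]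
      gcongr
      refine (hle x y).trans ?_
      rw [kernelBound]
      have h1 := norm_exp_inner_sub_one_le (x - x₀) y
      rw [max_eq_left (by rw [← dist_eq_norm]; exact (Metric.mem_ball.1 hx).le), one_mul] at h1
      gcongr
    · rw [lintegral_const_mul' _ _ (by finiteness)]
      exact (ENNReal.mul_lt_top (by finiteness) hint).ne
    · have hc : Continuous fun x : Vec d =>
          2 * (‖Complex.exp (Complex.I * ((⟪x - x₀, y⟫ : ℝ) : ℂ)) - 1‖ * ‖op (opPow (ψ y)
            (-D - (E.trace / α) • (1 : Matrix (Fin m) (Fin m) ℝ)))‖) := by fun_prop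
      have h1 := hc.tendsto x₀
      simp only [sub_self, inner_zero_left, Complex.ofReal_zero, mul_zero, Complex.exp_zero,
        norm_zero, zero_mul] at h1
      have h2 := squeeze_zero (fun x => opSize_nonneg _) (fun x => hle x y) h1
      have h3 := ((ENNReal.continuous_rpow_const (y := α)).tendsto _).comp (ENNReal.tendsto_ofReal h2)
      rwa [ENNReal.ofReal_zero, ENNReal.zero_rpow_of_pos hα] at h3
  have h2 := ENNReal.Tendsto.const_mul h0 (Or.inr (by norm_num : (2 : ℝ≥0∞) ≠ ∞))
  rw [lintegral_zero, mul_zero] at h2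
  exact tendsto_of_tendsto_of_tendsto_of_le_of_le tendsto_const_nhds h2 (fun _ => zero_le)
    fun x => alphaSize_le hα.le _

/-- For `0 < ⟪x, y⟫ < 2π` the scalar `e^{i⟨x,y⟩} - 1` is nonzero, and a matrix exponential is
invertible. -/
lemma coef_harmonizableKernel_ne_zero {x y θ : Vec _} (hθ : θ ≠ 0) (h0 : 0 < ⟪x, y⟫)
    (h1 : ⟪x, y⟫ < 2 * Real.pi) : coef θ (harmonizableKernel α E D ψ x y) ≠ 0 := by
  set B := opPow (ψ y) (-D - (E.trace / α) • (1 : Matrix (Fin m) (Fin m) ℝ)) with hB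
  set c := Complex.exp (Complex.I * ((⟪x, y⟫ : ℝ) : ℂ)) - 1 with hc
  have hcne : c ≠ 0 := by
    intro h
    rw [hc, sub_eq_zero, Complex.exp_eq_one_iff] at h
    obtain ⟨n, hn⟩ := h
    have h2 : ⟪x, y⟫ = n * (2 * Real.pi) := by
      have h3 : Complex.I * ((⟪x, y⟫ : ℝ) : ℂ) = Complex.I * ((n * (2 * Real.pi) : ℝ) : ℂ) := by
        rw [hn]; push_cast; ring
      exact_mod_cast mul_left_cancel₀ Complex.I_ne_zero h3
    rw [h2] at h0 h1
    have hπ := Real.two_pi_pos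
    have hn0 : (0 : ℝ) < n := pos_of_mul_pos_left h0 hπ.le
    have hn1 : (n : ℝ) < 1 := by
      by_contra hcon
      nlinarith
    have : (0 : ℤ) < n := by exact_mod_cast hn0
    have : n < (1 : ℤ) := by exact_mod_cast hn1
    omega
  intro h
  have h2 : ‖c‖ * ‖coef θ (B.map (fun t : ℝ => (t : ℂ)))‖ = 0 := by
    have h3 := norm_sum_coef_smul (k := 1) (fun _ => θ) (fun _ => B.map (fun t : ℝ => (t : ℂ))) c
    simp only [Finset.univ_unique, Finset.sum_singleton] at h3
    rw [← h3, norm_eq_zero]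
    exact h
  have h4 : coef θ (B.map (fun t : ℝ => (t : ℂ))) = 0 := by
    simpa [hcne] using h2
  have h5 : op Bᵀ θ = 0 := by
    ext k
    have h6 : (coef θ (B.map (fun t : ℝ => (t : ℂ)))) (Sum.inl k) = 0 := by rw [h4]; rfl
    have h7 : (op Bᵀ θ) k = (Bᵀ *ᵥ (WithLp.ofLp θ)) k := rfl
    rw [h7]
    simpa [coef, Matrix.mulVec, dotProduct, mul_comm] using h6
  have hBu : IsUnit Bᵀ := by
    rw [hB, ← opPow_transpose]
    exact Matrix.isUnit_exp _
  obtain ⟨A, hA⟩ := hBu.exists_left_inv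
  apply hθ
  calc θ = op (A * Bᵀ) θ := by rw [hA, op_one]; rfl
    _ = 0 := by rw [op_mul_apply, h5, map_zero]

lemma jointSize_harmonizableKernel_ne_zero [NeZero d] (hψ : Continuous ψ) (hα : 0 < α) {x : Vec d}
    {θ : Vec m} (hx : x ≠ 0) (hθ : θ ≠ 0) :
    jointSize α (fun _ : Fin 1 => θ) (fun _ => harmonizableKernel α E D ψ x) ≠ 0 := by
  intro h
  rw [jointSize, lintegral_eq_zero_iff (measurable_enorm_sum_coef _
    fun _ => measurable_harmonizableKernel hψ x)] at h
  set U : Set (Vec d) := {y | 0 < ⟪x, y⟫ ∧ ⟪x, y⟫ < 2 * Real.pi} with hU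
  have hin : Continuous fun y : Vec d => ⟪x, y⟫ := by fun_prop
  have hUo : IsOpen U := (isOpen_lt continuous_const hin).inter (isOpen_lt hin continuous_const)
  have hUne : U.Nonempty := by
    -- Chosen so that its inner product with `x` is `π`, the middle of the strip.
    refine ⟨(Real.pi / ‖x‖ ^ 2) • x, ?_⟩
    have hx' : ‖x‖ ^ 2 ≠ 0 := by simpa using hx
    have h1 : ⟪x, (Real.pi / ‖x‖ ^ 2) • x⟫ = Real.pi := by
      rw [inner_smul_right, real_inner_self_eq_norm_sq]
      field_simp
    rw [hU, Set.mem_ofPred_eq, h1]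
    exact ⟨Real.pi_pos, by linarith [Real.pi_pos]⟩
  have hUpos := (hUo.measure_pos volume hUne).ne'
  apply hUpos
  refine measure_mono_null (fun y hy => ?_) h
  have h1 := coef_harmonizableKernel_ne_zero (α := α) (E := E) (D := D) (ψ := ψ) hθ hy.1 hy.2
  simp only [Finset.univ_unique, Finset.sum_const, Finset.card_singleton, one_smul,
    Set.mem_compl_iff, Set.mem_ofPred_eq, Pi.zero_apply]
  intro h2
  rw [ENNReal.rpow_eq_zero_iff_of_pos hα, enorm_eq_zero] at h2
  exact h1 h2

/-- `r^{-E*}` is adjoint to `r^{-E}`, so the inner product is unchanged, while `ψ` is divided by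
`r`; the power `-D - q/α` turns this into `r ^ D` times `r ^ (q/α)`. -/
lemma harmonizableKernel_scaling (hψ_pos : ∀ y, y ≠ 0 → 0 < ψ y) (hψ_hom : IsHomogeneous Eᵀ ψ)
    {r : ℝ} (hr : 0 < r) (x : Vec d) {z : Vec d} (hz : z ≠ 0) :
    harmonizableKernel α E D ψ (op (opPow r E) x) (op (opPow r⁻¹ Eᵀ) z) =
      ((r ^ (E.trace / α) : ℝ) : ℂ) • ((opPow r D).map (fun t : ℝ => (t : ℂ)) *
        harmonizableKernel α E D ψ x z) := by
  have hinner : ⟪op (opPow r E) x, op (opPow r⁻¹ Eᵀ) z⟫ = ⟪x, z⟫ := by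
    rw [← inner_op_transpose, ← opPow_transpose, ← op_mul_apply, opPow_mul_inv hr, op_one]
    rfl
  have hpow : opPow (r⁻¹ * ψ z) (-D - (E.trace / α) • (1 : Matrix (Fin m) (Fin m) ℝ)) =
      r ^ (E.trace / α) • (opPow r D *
        opPow (ψ z) (-D - (E.trace / α) • (1 : Matrix (Fin m) (Fin m) ℝ))) := by
    rw [opPow_mul (inv_pos.2 hr) (hψ_pos z hz), opPow_neg_sub_smul_one (inv_pos.2 hr), inv_inv,
      smul_mul_assoc, Real.inv_rpow hr.le, Real.rpow_neg hr.le, inv_inv]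
  rw [harmonizableKernel, hinner, hψ_hom _ (inv_pos.2 hr) z hz, hpow, harmonizableKernel,
    Matrix.mul_smul, smul_comm]
  congr 1
  ext i j
  simp [Matrix.mul_apply]

/-- Under `y = r^{-E*} z` both sides acquire the factor `r ^ q`: from the Jacobian, and from the
`α`-th power of `r ^ (q/α)`. This cancellation explains the exponent `q/α` in the kernel. -/
lemma jointSize_scaling [NeZero d] (hα : 0 < α) (hψ_cont : Continuous ψ)
    (hψ_pos : ∀ y, y ≠ 0 → 0 < ψ y)
    (hψ_hom : IsHomogeneous Eᵀ ψ) {r : ℝ} (hr : 0 < r) {k : ℕ} (t : Fin k → Vec d)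
    (θ : Fin k → Vec m) :
    jointSize α θ (fun j => harmonizableKernel α E D ψ (op (opPow r E) (t j))) =
      jointSize α (fun j => op (opPow r D)ᵀ (θ j)) (fun j => harmonizableKernel α E D ψ (t j)) := by
  have h1 := lintegral_comp_op_opPow (inv_pos.2 hr) Eᵀ
    (fun y => ‖∑ j, coef (θ j) (harmonizableKernel α E D ψ (op (opPow r E) (t j)) y)‖ₑ ^ α)
    (measurable_enorm_sum_coef _ fun _ => measurable_harmonizableKernel hψ_cont _)
  have hrq : (r⁻¹ : ℝ) ^ (-Eᵀ.trace) = r ^ E.trace := by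
    rw [Matrix.trace_transpose, Real.inv_rpow hr.le, Real.rpow_neg hr.le, inv_inv]
  rw [hrq] at h1
  have h2 : ∫⁻ z, ‖∑ j, coef (θ j) (harmonizableKernel α E D ψ (op (opPow r E) (t j))
      (op (opPow r⁻¹ Eᵀ) z))‖ₑ ^ α = ENNReal.ofReal (r ^ E.trace) *
      jointSize α (fun j => op (opPow r D)ᵀ (θ j)) (fun j => harmonizableKernel α E D ψ (t j)) := by
    rw [jointSize, ← lintegral_const_mul' _ _ ENNReal.ofReal_ne_top]
    have h0 : ∀ᵐ y : Vec d, y ≠ 0 := by simp [ae_iff]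
    refine lintegral_congr_ae ?_
    filter_upwards [h0] with z hz
    simp_rw [harmonizableKernel_scaling hψ_pos hψ_hom hr _ hz, coef_op_transpose]
    rw [← ofReal_norm, norm_sum_coef_smul, Complex.norm_real, Real.norm_of_nonneg (by positivity),
      ENNReal.ofReal_mul (by positivity), ofReal_norm, ENNReal.mul_rpow_of_nonneg _ _ hα.le,
      ENNReal.ofReal_rpow_of_nonneg (by positivity) hα.le, ← Real.rpow_mul hr.le,
      div_mul_cancel₀ _ hα.ne']
  rw [h2] at h1
  have hpos : ENNReal.ofReal (r ^ E.trace) ≠ 0 := (ENNReal.ofReal_pos.2 (by positivity)).ne'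
  exact ((ENNReal.mul_right_inj hpos ENNReal.ofReal_ne_top).1 h1).symm

end HarmonizableKernel

/-! ### The five properties of the field -/

section FieldProperties

variable {d m : ℕ} {α : ℝ} {E : Matrix (Fin d) (Fin d) ℝ} {D : Matrix (Fin m) (Fin m) ℝ}
  {ψ : Vec d → ℝ} {Ω : Type*} [MeasurableSpace Ω] {P : Measure Ω} {X : Vec d → Ω → Vec m}

lemma isSymmetricStableField_of_charFun [IsProbabilityMeasure P] (hα : 0 < α) (hX : ∀ x, Measurable (X x))
    (h : ∀ (k : ℕ) (t : Fin k → Vec d), HasJointCharFun α P (fun j => X (t j))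
      (fun j => harmonizableKernel α E D ψ (t j))) : IsSymmetricStableField α P X :=
  ⟨hX, fun k t => (h k t).isSymmetricStable hα fun j => hX (t j)⟩

lemma stochasticallyContinuous_of_charFun [IsProbabilityMeasure P] (hα : 0 < α) (hψ : Continuous ψ)
    (hint : ∫⁻ y, ENNReal.ofReal (kernelBound α E D ψ y) ^ α < ∞) (hX : ∀ x, Measurable (X x))
    (h : ∀ (k : ℕ) (t : Fin k → Vec d), HasJointCharFun α P (fun j => X (t j))
      (fun j => harmonizableKernel α E D ψ (t j))) : StochasticallyContinuous P X := by
  intro x₀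
  rw [tendstoInMeasure_iff_norm]
  intro ε hε
  obtain ⟨C, hC, hb⟩ := exists_measure_le_norm_sub_le (d := d) (m := m) (P := P) hα hε
  have h1 := ENNReal.Tendsto.const_mul (tendsto_alphaSize_harmonizableKernel hα hψ hint x₀)
    (Or.inr hC)
  rw [mul_zero] at h1
  refine tendsto_of_tendsto_of_tendsto_of_le_of_le tendsto_const_nhds h1 (fun _ => zero_le)
    fun x => ?_
  exact hb (fun j => X (![x, x₀] j)) (fun j => harmonizableKernel α E D ψ (![x, x₀] j))
    (fun j => hX _) (h 2 ![x, x₀])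

/-- If `⟪θ, X x⟫` were almost surely constant, its characteristic function would have modulus `1`,
forcing the real value of `jointSize` to vanish; but `jointSize` is neither zero nor infinite. -/
lemma isProper_of_charFun [IsProbabilityMeasure P] [NeZero d] (hα : 0 < α) (hψ : Continuous ψ)
    (hint : ∫⁻ y, ENNReal.ofReal (kernelBound α E D ψ y) ^ α < ∞) (hX : ∀ x, Measurable (X x))
    (h : ∀ (k : ℕ) (t : Fin k → Vec d), HasJointCharFun α P (fun j => X (t j))
      (fun j => harmonizableKernel α E D ψ (t j))) : IsProper P X := by
  intro x hx θ hθ c hsupp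
  have h1 : ∀ᵐ v ∂(P.map (X x)), ⟪θ, v⟫ = c :=
    Filter.mem_of_superset Measure.support_mem_ae hsupp
  have h2 : ∀ᵐ ω ∂P, ⟪θ, X x ω⟫ = c := ae_of_ae_map (hX x).aemeasurable h1
  have h3 := h 1 (fun _ => x) (fun _ => θ)
  have h4 : ∫ ω, Complex.exp (((∑ _j : Fin 1, ⟪θ, X x ω⟫ : ℝ) : ℂ) * Complex.I) ∂P =
      ∫ _ω, Complex.exp ((c : ℂ) * Complex.I) ∂P := by
    refine integral_congr_ae ?_
    filter_upwards [h2] with ω hω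
    simp [hω]
  rw [h4, integral_const, probReal_univ, one_smul] at h3
  have h5 := congrArg norm h3
  rw [Complex.norm_exp_ofReal_mul_I, ← Complex.ofReal_neg, Complex.norm_exp_ofReal] at h5
  have h6 := (Real.exp_eq_one_iff _).1 h5.symm
  rw [neg_eq_zero, ENNReal.toReal_eq_zero_iff] at h6
  rcases h6 with h6 | h6
  · exact jointSize_harmonizableKernel_ne_zero hψ hα hx hθ h6
  · exact (jointSize_lt_top hα _ fun _ => isIntegrand_harmonizableKernel hα hψ hint x).ne h6

lemma isOperatorSelfSimilar_of_charFun [IsProbabilityMeasure P] [NeZero d] (hα : 0 < α) (hψ : Continuous ψ)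
    (hψ_pos : ∀ y, y ≠ 0 → 0 < ψ y) (hψ_hom : IsHomogeneous Eᵀ ψ) (hX : ∀ x, Measurable (X x))
    (h : ∀ (k : ℕ) (t : Fin k → Vec d), HasJointCharFun α P (fun j => X (t j))
      (fun j => harmonizableKernel α E D ψ (t j))) : IsOperatorSelfSimilar E D P X := by
  intro r hr k t
  refine identDistrib_of_integral_exp_eq (X := fun j => X (op (opPow r E) (t j)))
    (Y := fun j ω => op (opPow r D) (X (t j) ω)) (fun j => hX _)
    (fun j => (op (opPow r D)).continuous.measurable.comp (hX _)) fun θ => ?_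
  have h1 := h k (fun j => op (opPow r E) (t j)) θ
  have h2 := h k t (fun j => op (opPow r D)ᵀ (θ j))
  rw [jointSize_scaling hα hψ hψ_pos hψ_hom hr, ← h2] at h1
  rw [h1]
  congr 1
  funext ω
  congr 3
  refine Finset.sum_congr rfl fun j _ => ?_
  rw [real_inner_comm, inner_op_transpose, real_inner_comm]

/-- The increments form one functional of the field at `b` and at the points `t j + b`, with test
vector `-∑ θ j` at `b`. The kernels then combine to the phase `e^{i⟨b,y⟩}` times the unshifted
kernels, so the result does not depend on `b`. -/
lemma integral_exp_increments
    (h : ∀ (k : ℕ) (t : Fin k → Vec d), HasJointCharFun α P (fun j => X (t j))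
      (fun j => harmonizableKernel α E D ψ (t j))) {k : ℕ} (t : Fin k → Vec d) (θ : Fin k → Vec m)
    (b : Vec d) :
    ∫ ω, Complex.exp (((∑ j, ⟪θ j, X (t j + b) ω - X b ω⟫ : ℝ) : ℂ) * Complex.I) ∂P =
      Complex.exp (-(((jointSize α θ fun j => harmonizableKernel α E D ψ (t j)).toReal : ℝ) : ℂ)) := by
  have h1 := h (k + 1) (Fin.cons b fun j => t j + b) (Fin.cons (-∑ j, θ j) θ)
  have h2 : jointSize α (Fin.cons (-∑ j, θ j) θ : Fin (k + 1) → Vec m) (fun j =>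
      harmonizableKernel α E D ψ ((Fin.cons b fun j => t j + b : Fin (k + 1) → Vec d) j)) =
      jointSize α θ fun j => harmonizableKernel α E D ψ (t j) := by
    refine lintegral_congr fun y => ?_
    congr 1
    rw [Fin.sum_univ_succ]
    simp only [Fin.cons_zero, Fin.cons_succ]
    rw [coef_neg_left, coef_sum_left, neg_add_eq_sub, ← Finset.sum_sub_distrib]
    simp_rw [← coef_sub_right, harmonizableKernel_add_sub]
    rw [← ofReal_norm, norm_sum_coef_smul, Complex.norm_exp_I_mul_ofReal, one_mul, ofReal_norm]
  rw [h2] at h1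
  rw [← h1]
  congr 1
  funext ω
  congr 3
  rw [Fin.sum_univ_succ]
  simp only [Fin.cons_zero, Fin.cons_succ, inner_neg_left, sum_inner, inner_sub_right,
    Finset.sum_sub_distrib]
  ring

lemma hasStationaryIncrements_of_charFun [IsProbabilityMeasure P] (hX : ∀ x, Measurable (X x))
    (h : ∀ (k : ℕ) (t : Fin k → Vec d), HasJointCharFun α P (fun j => X (t j))
      (fun j => harmonizableKernel α E D ψ (t j))) : HasStationaryIncrements P X := by
  intro b k t
  refine identDistrib_of_integral_exp_eq (X := fun j ω => X (t j + b) ω - X b ω)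
    (Y := fun j ω => X (t j) ω - X 0 ω) (fun j => (hX _).sub (hX _))
    (fun j => (hX _).sub (hX _)) fun θ => ?_
  have h1 := integral_exp_increments h t θ 0
  simp only [add_zero] at h1
  rw [h1, integral_exp_increments h]

end FieldProperties

end StableField

theorem mainTheorem5 {d m : ℕ} (hd : 2 ≤ d) (hm : 2 ≤ m)
    (α : ℝ) (hα_pos : 0 < α) (hα_le : α ≤ 2)
    (E : Matrix (Fin d) (Fin d) ℝ) (hE : E ∈ posOperators d)
    (D : Matrix (Fin m) (Fin m) ℝ) (hD : D ∈ posOperators m)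
    (hDE : maxRealPart D < minRealPart E)
    (ψ : Vec d → ℝ) (hψ_cont : Continuous ψ) (hψ_nonneg : ∀ y, 0 ≤ ψ y)
    (hψ_ne : ∀ y, y ≠ 0 → ψ y ≠ 0) (hψ_hom : IsHomogeneous Eᵀ ψ)
    {Ω : Type*} [MeasurableSpace Ω] (P : Measure Ω) [IsProbabilityMeasure P]
    (M : Set (Vec d) → Ω → EuclideanSpace ℝ (Fin m ⊕ Fin m))
    (hM : IsStableRandomMeasure α (controlMeasure d (Fin m ⊕ Fin m) α) P M) :
    -- the stochastic integrals are well defined: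
    -- admissible integrands, existence and almost sure uniqueness
    (∀ x, IsIntegrand α (harmonizableKernel α E D ψ x)) ∧
    (∀ x, ∃ Y : Ω → Vec m, IsReIntegral α P M (harmonizableKernel α E D ψ x) Y) ∧
    (∀ x, ∀ Y Y' : Ω → Vec m, IsReIntegral α P M (harmonizableKernel α E D ψ x) Y →
      IsReIntegral α P M (harmonizableKernel α E D ψ x) Y' → Y =ᵐ[P] Y') ∧
    -- properties of the field
    (∀ X : Vec d → Ω → Vec m,
      (∀ x, IsReIntegral α P M (harmonizableKernel α E D ψ x) (X x)) →
      IsSymmetricStableField α P X ∧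
      StochasticallyContinuous P X ∧
      IsProper P X ∧
      IsOperatorSelfSimilar E D P X ∧
      HasStationaryIncrements P X) := by
  have : NeZero d := ⟨by omega⟩
  have : NeZero m := ⟨by omega⟩
  have hψ_pos : ∀ y, y ≠ 0 → 0 < ψ y := fun y hy => lt_of_le_of_ne (hψ_nonneg y) (hψ_ne y hy).symm
  have hint := lintegral_kernelBound_lt_top hα_pos hE hD hDE hψ_cont hψ_pos hψ_hom
  have hK := isIntegrand_harmonizableKernel hα_pos hψ_cont hint
  refine ⟨hK, fun x => exists_isReIntegral hα_pos hM (hK x), fun x Y Y' hY hY' =>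
    hY.ae_eq hα_pos hY', fun X hX => ?_⟩
  have hmeas : ∀ x, Measurable (X x) := fun x => (hX x).measurable
  have hchar : ∀ (k : ℕ) (t : Fin k → Vec d), HasJointCharFun α P (fun j => X (t j))
      (fun j => harmonizableKernel α E D ψ (t j)) := fun k t =>
    HasJointCharFun.of_isReIntegral hα_pos hM fun j => hX (t j)
  exact ⟨isSymmetricStableField_of_charFun hα_pos hmeas hchar,
    stochasticallyContinuous_of_charFun hα_pos hψ_cont hint hmeas hchar,
    isProper_of_charFun hα_pos hψ_cont hint hmeas hchar,
    isOperatorSelfSimilar_of_charFun hα_pos hψ_cont hψ_pos hψ_hom hmeas hchar,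
    hasStationaryIncrements_of_charFun hmeas hchar⟩
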